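/- Let $Z$ be an arbitrary abelian topological group, let $K$ be a topological group, and let $Z\hookrightarrow\hat K\to K$ be a central extension of topological groups which is a locally trivial principal $Z$-bundle. For a topological group $G$ let $\underline G$ be the sheaf of continuous $G$-valued functions, and let $\check H^\bullet$ denote Čech cohomology (the limit over all open covers). The class $[P]\in\check H^1(X,\underline G)$ of a principal $G$-bundle $P\to X$ (with $G$ acting from the right) is given by the transition functions $g_{ij}$ defined by $s_i=s_j\cdot g_{ij}$ for local sections $s_i$; so cocycles satisfy $g_{jk}g_{ij}=g_{ik}$. The connecting maps $\delta_0\colon C(X,K)\to\check H^1(X,\underline Z)$ and $\delta_1\colon\check H^1(X,\underline K)\to\check H^2(X,\underline Z)$ (for $X$ paracompact Hausdorff) are $\delta_0(f)=[\hat f_i\hat f_j^{-1}]$ and $\delta_1([g_{ij}])=[\hat g_{jk}\hat g_{ij}\hat g_{ik}^{-1}]$, where $\hat f_i$ and $\hat g_{ij}$ are continuous $\hat K$-valued lifts of $f$ and $g_{ij}$ on a sufficiently fine open cover. Realize $\mathbb S^n$ as the boundary of the simplex $\Delta^{n+1}=[e_0,\dots,e_{n+1}]$, and regard it as the boundary of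 the face $F=[e_0,\dots,e_{n+1}]$ of $\Delta^{n+2}$, hence as a subset (the equator) of $\mathbb S^{n+1}=\partial\Delta^{n+2}$. Let $C\subseteq\mathbb S^{n+1}$ be the union of the other faces, so that $\mathbb S^{n+1}=C\cup F$ and $C\cap F=\mathbb S^n$, and let $p\colon C\setminus\{e_{n+2}\}\to\mathbb S^n$ be the radial retraction. An open cover $(U_i)_{i\in I}$ of $\mathbb S^n$ yields the open cover of $\mathbb S^{n+1}$ consisting of $V_i=p^{-1}(U_i)\cup(F\setminus\mathbb S^n)$, $i\in I$, and of $V_\infty=\mathbb S^{n+1}\setminus F$. The suspension map $\Sigma_1\colon\check H^1(\mathbb S^n,\underline Z)\to\check H^2(\mathbb S^{n+1},\underline Z)$ sends $[z_{ij}]$ to $[h]$, where $h_{ij\infty}=z_{ij}\circ p$, $h_{i\infty j}=-z_{ij}\circ p$, $h_{\infty ij}=z_{ij}\circ p$ for $i,j\in I$, and $h=0$ at all other triples of indices. Likewise $\Sigma_0\colon C(\mathbb S^n,K)\to\check H^1(\mathbb S^{n+1},\underline K)$ sends $f$ to the class of the cocycle $h_{i\infty}=f\circ p$, $h_{\infty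 i}=(f\circ p)^{-1}$, $h_{ij}=h_{\infty\infty}=1$. For a continuous map $f\colon\mathbb S^n\to K$ let $P_f\to\mathbb S^{n+1}$ be the clutched principal $K$-bundle, that is, the quotient of $(C\times K)\sqcup(F\times K)$ in which, for each $x\in\mathbb S^n$ and $k\in K$, the point $(x,f(x)k)$ of $C\times K$ is identified with the point $(x,k)$ of $F\times K$. Then for every integer $n\ge 0$ and every continuous map $f\colon\mathbb S^n\to K$, $$\Sigma_0(f)=[P_f],\qquad \delta_1([P_f])=-\Sigma_1(\delta_0(f)),\qquad \delta_0(f)=[f^*\hat K],$$ so that in particular $\delta_1\circ\Sigma_0=-\Sigma_1\circ\delta_0$. -/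

import Mathlib

open Set Topology

universe u v w

/-! ### Čech cohomology in degrees one and two

Open covers of `X` are indexed by the points of `X`, with `x ∈ U x`; these covers are cofinal among
all open covers, and they are directed under pointwise inclusion, so that the limit over them is
the Čech cohomology of `X`. Partially defined functions are represented by total
functions; only their values on the indicated open sets matter. -/

/-- An open cover `(U x)` of `X` indexed by the points of `X`, with `x ∈ U x`. -/
structure PtCover (X : Type*) [TopologicalSpace X] where
  set : X → Set X
  isOpen : ∀ x, IsOpen (set x)
  mem : ∀ x, x ∈ set x

/-- The common refinement of two covers. -/
def PtCover.inter {X : Type*} [TopologicalSpace X] (U V : PtCover X) : PtCover X where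
  set x := U.set x ∩ V.set x
  isOpen x := (U.isOpen x).inter (V.isOpen x)
  mem x := ⟨U.mem x, V.mem x⟩

/-- A family of open neighbourhoods, one for each point, is a cover. -/
theorem exists_ptCover {X : Type*} [TopologicalSpace X] {p : X → Set X → Prop}
    (h : ∀ x, ∃ U, IsOpen U ∧ x ∈ U ∧ p x U) : ∃ U : PtCover X, ∀ x, p x (U.set x) := by
  choose U h1 h2 h3 using h
  exact ⟨⟨U, h1, h2⟩, h3⟩

section H1

variable (X : Type*) [TopologicalSpace X] (G : Type*) [Group G] [TopologicalSpace G]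

variable {X G} in
/-- `g` is a one-cocycle on the cover `U`, with values in the (not necessarily commutative) group
`G`: the `g i j` are continuous on `U i ∩ U j`, and they compose like the transition functions of
local sections `s i = s j • g i j` of a principal bundle with `G` acting from the right. -/
def IsCocycle1 (U : PtCover X) (g : X → X → X → G) : Prop :=
  (∀ i j, ContinuousOn (g i j) (U.set i ∩ U.set j)) ∧
    ∀ i j k, ∀ x ∈ U.set i ∩ U.set j ∩ U.set k, g j k x * g i j x = g i k x

/-- The one-cocycles on open covers of `X`. -/
def Cocycle1 : Type _ := {g : X → X → X → G // ∃ U : PtCover X, IsCocycle1 U g}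

variable {X G} in
/-- Two one-cocycles are cohomologous: after passing to a common refinement, they
differ by a change `s' i = s i • b i` of the local sections. -/
def Cohomologous1 (g h : X → X → X → G) : Prop :=
  ∃ (U : PtCover X) (b : X → X → G), (∀ i, ContinuousOn (b i) (U.set i)) ∧
    ∀ i j, ∀ x ∈ U.set i ∩ U.set j, h i j x = (b j x)⁻¹ * g i j x * b i x

/-- Being cohomologous is an equivalence relation. -/
def cocycle1Setoid [IsTopologicalGroup G] : Setoid (Cocycle1 X G) where
  r g h := Cohomologous1 g.1 h.1
  iseqv := by
    refine ⟨fun g => ?_, ?_, ?_⟩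
    · obtain ⟨U, hU⟩ := g.2
      exact ⟨U, fun _ _ => 1, fun i => continuousOn_const, fun i j x _ => by simp⟩
    · rintro g h ⟨U, b, hb, hgh⟩
      refine ⟨U, fun i x => (b i x)⁻¹, fun i => (hb i).inv, fun i j x hx => ?_⟩
      rw [hgh i j x hx]; group
    · rintro g h k ⟨U, b, hb, hgh⟩ ⟨V, c, hc, hhk⟩
      refine ⟨U.inter V, fun i x => b i x * c i x, fun i => ?_, fun i j x hx => ?_⟩
      · exact ((hb i).mono inter_subset_left).mul ((hc i).mono inter_subset_right)
      · rw [hhk i j x ⟨hx.1.2, hx.2.2⟩, hgh i j x ⟨hx.1.1, hx.2.1⟩]; group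

/-- The first Čech cohomology set of `X` with values in the sheaf of continuous functions into the
topological group `G`. -/
def CechH1 [IsTopologicalGroup G] : Type _ := Quotient (cocycle1Setoid X G)

variable {X G} in
/-- The class of a one-cocycle. -/
def CechH1.mk [IsTopologicalGroup G] (g : Cocycle1 X G) : CechH1 X G :=
  Quotient.mk (cocycle1Setoid X G) g

end H1

section H2

variable (X : Type*) [TopologicalSpace X] (Z : Type*) [CommGroup Z] [TopologicalSpace Z]
  [IsTopologicalGroup Z]

variable {X Z} in
/-- `c` is a two-cocycle on the cover `U`, with values in the abelian group `Z`. -/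
def IsCocycle2 (U : PtCover X) (c : X → X → X → X → Z) : Prop :=
  (∀ i j k, ContinuousOn (c i j k) (U.set i ∩ U.set j ∩ U.set k)) ∧
    ∀ i j k l, ∀ x ∈ U.set i ∩ U.set j ∩ U.set k ∩ U.set l,
      c j k l x * (c i k l x)⁻¹ * c i j l x * (c i j k x)⁻¹ = 1

variable {X Z} in
/-- `c` is, on the cover `U`, the coboundary of a one-cochain. -/
def IsCoboundary2 (U : PtCover X) (c : X → X → X → X → Z) : Prop :=
  ∃ b : X → X → X → Z, (∀ i j, ContinuousOn (b i j) (U.set i ∩ U.set j)) ∧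
    ∀ i j k, ∀ x ∈ U.set i ∩ U.set j ∩ U.set k,
      c i j k x = b j k x * (b i k x)⁻¹ * b i j x

/-- The group of two-cocycles on open covers of `X`. -/
def Cocycle2 : Subgroup (X → X → X → X → Z) where
  carrier := {c | ∃ U : PtCover X, IsCocycle2 U c}
  one_mem' := ⟨⟨fun _ => univ, fun _ => isOpen_univ, fun _ => mem_univ _⟩,
    fun _ _ _ => continuousOn_const, fun i j k l x _ => by simp⟩
  mul_mem' := by
    rintro c d ⟨U, hU, hc⟩ ⟨V, hV, hd⟩
    refine ⟨U.inter V, fun i j k => ?_, fun i j k l x hx => ?_⟩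
    · exact ((hU i j k).mono fun x hx => ⟨⟨hx.1.1.1, hx.1.2.1⟩, hx.2.1⟩).mul
        ((hV i j k).mono fun x hx => ⟨⟨hx.1.1.2, hx.1.2.2⟩, hx.2.2⟩)
    · have h1 := hc i j k l x ⟨⟨⟨hx.1.1.1.1, hx.1.1.2.1⟩, hx.1.2.1⟩, hx.2.1⟩
      have h2 := hd i j k l x ⟨⟨⟨hx.1.1.1.2, hx.1.1.2.2⟩, hx.1.2.2⟩, hx.2.2⟩
      have h3 := congrArg₂ (· * ·) h1 h2
      simp only [mul_one] at h3
      rw [← h3]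
      simp only [Pi.mul_apply, mul_inv]
      ac_rfl
  inv_mem' := by
    rintro c ⟨U, hU, hc⟩
    refine ⟨U, fun i j k => (hU i j k).inv, fun i j k l x hx => ?_⟩
    have h1 := congrArg (·⁻¹) (hc i j k l x hx)
    simp only [inv_one] at h1
    rw [← h1]
    simp only [Pi.inv_apply, mul_inv]

/-- The group of two-coboundaries: families which are coboundaries on some open cover. -/
def Coboundary2 : Subgroup (X → X → X → X → Z) where
  carrier := {c | ∃ U : PtCover X, IsCoboundary2 U c}
  one_mem' := ⟨⟨fun _ => univ, fun _ => isOpen_univ, fun _ => mem_univ _⟩,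
    fun _ _ _ => 1, fun _ _ => continuousOn_const, fun i j k x _ => by simp⟩
  mul_mem' := by
    rintro c d ⟨U, b, hb, hc⟩ ⟨V, b', hb', hd⟩
    refine ⟨U.inter V, fun i j x => b i j x * b' i j x, fun i j => ?_, fun i j k x hx => ?_⟩
    · exact ((hb i j).mono fun x hx => ⟨hx.1.1, hx.2.1⟩).mul
        ((hb' i j).mono fun x hx => ⟨hx.1.2, hx.2.2⟩)
    · have h1 := hc i j k x ⟨⟨hx.1.1.1, hx.1.2.1⟩, hx.2.1⟩
      have h2 := hd i j k x ⟨⟨hx.1.1.2, hx.1.2.2⟩, hx.2.2⟩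
      simp only [Pi.mul_apply, h1, h2, mul_inv]
      ac_rfl
  inv_mem' := by
    rintro c ⟨U, b, hb, hc⟩
    refine ⟨U, fun i j x => (b i j x)⁻¹, fun i j => (hb i j).inv, fun i j k x hx => ?_⟩
    simp only [Pi.inv_apply, hc i j k x hx, mul_inv]

/-- The second Čech cohomology group of `X`, written additively, with values in the sheaf of
continuous functions into the abelian topological group `Z`. -/
def CechH2 : Type _ := Additive (Cocycle2 X Z ⧸ (Coboundary2 X Z).subgroupOf (Cocycle2 X Z))

noncomputable instance : AddCommGroup (CechH2 X Z) :=
  inferInstanceAs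
    (AddCommGroup (Additive (Cocycle2 X Z ⧸ (Coboundary2 X Z).subgroupOf (Cocycle2 X Z))))

variable {X Z} in
/-- The class of a two-cocycle. -/
def CechH2.mk (c : Cocycle2 X Z) : CechH2 X Z :=
  Additive.ofMul (QuotientGroup.mk c)

variable {X Z} in
theorem CechH2.mk_eq_mk {c d : Cocycle2 X Z}
    (h : ∃ U : PtCover X, IsCoboundary2 U fun i j k x => (c.1 i j k x)⁻¹ * d.1 i j k x) :
    CechH2.mk c = CechH2.mk d := by
  refine congrArg Additive.ofMul (QuotientGroup.eq.mpr ?_)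
  rw [Subgroup.mem_subgroupOf]
  exact h

end H2

/-! ### Principal bundles -/

/-- `π : P → X` is a (locally trivial) principal bundle, where the group `G` acts on `P` from the
right by `act`: around every point of `X` there is an equivariant local trivialization. -/
def IsPrincipalBundle {X P G : Type*} [TopologicalSpace X] [TopologicalSpace P]
    [Group G] [TopologicalSpace G] (act : P → G → P) (π : P → X) : Prop :=
  ∀ x, ∃ e : Bundle.Trivialization G π, x ∈ e.baseSet ∧
    ∀ p g, π p ∈ e.baseSet → π (act p g) = π p ∧ (e (act p g)).2 = (e p).2 * g

/-- Principal `G`-bundles over `X`. -/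
structure PrincipalBundle (X : Type u) (G : Type v) [TopologicalSpace X] [Group G]
    [TopologicalSpace G] where
  /-- the total space -/
  Total : Type w
  [topology : TopologicalSpace Total]
  /-- the action of the structure group from the right -/
  act : Total → G → Total
  act_one : ∀ p, act p 1 = p
  act_mul : ∀ p g h, act p (g * h) = act (act p g) h
  /-- the projection -/
  proj : Total → X
  isPrincipal : IsPrincipalBundle act proj

attribute [instance] PrincipalBundle.topology

section BundleClass

variable {X : Type u} {G : Type v} [TopologicalSpace X] [Group G] [TopologicalSpace G]

theorem IsPrincipalBundle.exists_section {P : Type*} [TopologicalSpace P] {act : P → G → P}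
    {π : P → X} (h : IsPrincipalBundle act π) (x : X) :
    ∃ U, IsOpen U ∧ x ∈ U ∧ ∃ s : X → P, ContinuousOn s U ∧ ∀ y ∈ U, π (s y) = y := by
  obtain ⟨e, hx, -⟩ := h x
  refine ⟨e.baseSet, e.open_baseSet, hx, fun y => e.toOpenPartialHomeomorph.symm (y, 1), ?_, ?_⟩
  · refine e.continuousOn_invFun.comp (by fun_prop) fun y hy => ?_
    simpa [e.target_eq] using hy
  · intro y hy
    exact e.proj_symm_apply' hy

/-- The division map of a principal bundle is continuous. -/
theorem IsPrincipalBundle.exists_division [IsTopologicalGroup G] {P : Type*} [TopologicalSpace P]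
    {act : P → G → P} {π : P → X} (h : IsPrincipalBundle act π) {T : Type*} [TopologicalSpace T]
    {s t : T → P} {A : Set T} (hA : IsOpen A) (hs : ContinuousOn s A) (ht : ContinuousOn t A)
    (hst : ∀ a ∈ A, π (s a) = π (t a)) :
    ∃ g : T → G, ContinuousOn g A ∧ (∀ a ∈ A, s a = act (t a) (g a)) ∧
      ∀ a ∈ A, ∀ g' : G, s a = act (t a) g' → g' = g a := by
  choose e he1 he2 using h
  have key : ∀ x a, a ∈ A → π (t a) ∈ (e x).baseSet → ∀ g,
      s a = act (t a) g ↔ g = (e x (t a)).2⁻¹ * (e x (s a)).2 := by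
    intro x a ha hb g
    obtain ⟨h1, h2⟩ := he2 x (t a) g hb
    constructor
    · intro h; rw [h, h2]; group
    · intro h
      have hsx : s a ∈ (e x).source := by rw [(e x).mem_source, hst a ha]; exact hb
      have htx : act (t a) g ∈ (e x).source := by rw [(e x).mem_source, h1]; exact hb
      refine (e x).injOn hsx htx (Prod.ext ?_ ?_)
      · change ((e x) (s a)).1 = ((e x) (act (t a) g)).1
        rw [(e x).coe_fst hsx, (e x).coe_fst htx, h1, hst a ha]
      · change ((e x) (s a)).2 = ((e x) (act (t a) g)).2
        rw [h2, h]; group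
  refine ⟨fun a => (e (π (t a)) (t a)).2⁻¹ * (e (π (t a)) (s a)).2, ?_, ?_, ?_⟩
  · intro a ha
    have hta : t a ∈ (e (π (t a))).source := by rw [(e _).mem_source]; exact he1 _
    have hsa : s a ∈ (e (π (t a))).source := by rw [(e _).mem_source, hst a ha]; exact he1 _
    have c1 : ContinuousAt (fun b => (e (π (t a)) (t b)).2) a :=
      continuous_snd.continuousAt.comp
        (((e (π (t a))).continuousAt hta).comp (ht.continuousAt (hA.mem_nhds ha)))
    have c2 : ContinuousAt (fun b => (e (π (t a)) (s b)).2) a :=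
      continuous_snd.continuousAt.comp
        (((e (π (t a))).continuousAt hsa).comp (hs.continuousAt (hA.mem_nhds ha)))
    refine ((c1.inv.mul c2).congr ?_).continuousWithinAt
    have hn : ∀ᶠ b in 𝓝 a, t b ∈ (e (π (t a))).source :=
      (ht.continuousAt (hA.mem_nhds ha)).eventually_mem ((e (π (t a))).open_source.mem_nhds hta)
    filter_upwards [hn, hA.mem_nhds ha] with b hb hbA
    have hb' : π (t b) ∈ (e (π (t a))).baseSet := (e _).mem_source.mp hb
    exact (key _ b hbA (he1 _) _).mp ((key _ b hbA hb' _).mpr rfl)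
  · intro a ha
    exact (key _ a ha (he1 _) _).mpr rfl
  · intro a ha g' hg'
    exact (key _ a ha (he1 _) _).mp hg'

variable [IsTopologicalGroup G]

/-- `c` is the class given by transition functions `g i j`, where `s i = s j • g i j` for local
sections `s i` of the principal bundle `P`. -/
def PrincipalBundle.IsClass (P : PrincipalBundle.{u, v, w} X G) (c : CechH1 X G) : Prop :=
  ∃ (U : PtCover X) (s : X → X → P.Total), (∀ i, ContinuousOn (s i) (U.set i)) ∧
    (∀ i, ∀ x ∈ U.set i, P.proj (s i x) = x) ∧
    ∃ g : Cocycle1 X G, IsCocycle1 U g.1 ∧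
      (∀ i j, ∀ x ∈ U.set i ∩ U.set j, s i x = P.act (s j x) (g.1 i j x)) ∧ c = CechH1.mk g

theorem PrincipalBundle.exists_isClass (P : PrincipalBundle.{u, v, w} X G) :
    ∃ c, P.IsClass c := by
  obtain ⟨U, hU⟩ := exists_ptCover P.isPrincipal.exists_section
  choose s hs1 hs2 using hU
  have H : ∀ i j, ∃ g : X → G, ContinuousOn g (U.set i ∩ U.set j) ∧
      (∀ a ∈ U.set i ∩ U.set j, s i a = P.act (s j a) (g a)) ∧
      ∀ a ∈ U.set i ∩ U.set j, ∀ g', s i a = P.act (s j a) g' → g' = g a := fun i j =>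
    P.isPrincipal.exists_division ((U.isOpen i).inter (U.isOpen j))
      ((hs1 i).mono inter_subset_left) ((hs1 j).mono inter_subset_right)
      fun a ha => by rw [hs2 i a ha.1, hs2 j a ha.2]
  choose g hg1 hg2 hg3 using H
  have hc : IsCocycle1 U g := by
    refine ⟨hg1, fun i j k x hx => ?_⟩
    refine hg3 i k x ⟨hx.1.1, hx.2⟩ _ ?_
    rw [P.act_mul, ← hg2 j k x ⟨hx.1.2, hx.2⟩, ← hg2 i j x hx.1]
  exact ⟨_, U, s, hs1, hs2, ⟨g, U, hc⟩, hc, hg2, rfl⟩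

/-- The class of a principal bundle does not depend on the choice of local sections. -/
theorem PrincipalBundle.IsClass.unique {P : PrincipalBundle.{u, v, w} X G} {c c' : CechH1 X G}
    (h : P.IsClass c) (h' : P.IsClass c') : c = c' := by
  obtain ⟨U, s, hs1, hs2, g, hg, hsg, rfl⟩ := h
  obtain ⟨U', s', hs1', hs2', g', hg', hsg', rfl⟩ := h'
  have H : ∀ i, ∃ b : X → G, ContinuousOn b (U.set i ∩ U'.set i) ∧
      (∀ a ∈ U.set i ∩ U'.set i, s' i a = P.act (s i a) (b a)) ∧
      ∀ a ∈ U.set i ∩ U'.set i, ∀ b', s' i a = P.act (s i a) b' → b' = b a := fun i =>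
    P.isPrincipal.exists_division ((U.isOpen i).inter (U'.isOpen i))
      ((hs1' i).mono inter_subset_right) ((hs1 i).mono inter_subset_left)
      fun a ha => by rw [hs2' i a ha.2, hs2 i a ha.1]
  choose b hb1 hb2 hb3 using H
  refine Quotient.sound (s := cocycle1Setoid X G) ⟨U.inter U', b, hb1, fun i j x hx => ?_⟩
  have e : b j x * g'.1 i j x = g.1 i j x * b i x := by
    have h1 : s' i x = P.act (s j x) (b j x * g'.1 i j x) := by
      rw [P.act_mul, ← hb2 j x hx.2, ← hsg' i j x ⟨hx.1.2, hx.2.2⟩]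
    have h2 : s' i x = P.act (s j x) (g.1 i j x * b i x) := by
      rw [P.act_mul, ← hsg i j x ⟨hx.1.1, hx.2.1⟩, ← hb2 i x hx.1]
    obtain ⟨_, -, -, huniq⟩ := P.isPrincipal.exists_division (T := Unit) (s := fun _ => s' i x)
      (t := fun _ => s j x) isOpen_univ continuousOn_const continuousOn_const
      fun _ _ => by rw [hs2' i x hx.1.2, hs2 j x hx.2.1]
    exact (huniq () trivial _ h1).trans (huniq () trivial _ h2).symm
  rw [mul_assoc, ← e, inv_mul_cancel_left]

/-- The class `[P]` of a principal bundle in the first Čech cohomology. -/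
noncomputable def PrincipalBundle.cls (P : PrincipalBundle.{u, v, w} X G) : CechH1 X G :=
  P.exists_isClass.choose

end BundleClass

/-! ### Central extensions and connecting maps -/

/-- Central extensions `Z → K̂ → K` of topological groups which are locally trivial principal
`Z`-bundles. -/
structure CentralExtension (Z : Type u) (K : Type v) [CommGroup Z] [TopologicalSpace Z]
    [Group K] [TopologicalSpace K] where
  /-- the extension `K̂` -/
  Ext : Type w
  [group : Group Ext]
  [topology : TopologicalSpace Ext]
  [topologicalGroup : IsTopologicalGroup Ext]
  /-- the inclusion of the central subgroup -/
  incl : Z →* Ext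
  /-- the quotient map -/
  quot : Ext →* K
  continuous_incl : Continuous incl
  continuous_quot : Continuous quot
  incl_injective : Function.Injective incl
  quot_surjective : Function.Surjective quot
  range_eq_ker : incl.range = quot.ker
  central : ∀ z e, incl z * e = e * incl z
  locallyTrivial : IsPrincipalBundle (fun e z => e * incl z) quot

attribute [instance] CentralExtension.group CentralExtension.topology
  CentralExtension.topologicalGroup

section Connecting

variable {X : Type*} [TopologicalSpace X] {Z : Type u} {K : Type v} [CommGroup Z]
  [TopologicalSpace Z] [IsTopologicalGroup Z] [Group K] [TopologicalSpace K]
  [IsTopologicalGroup K]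

/-- `c` is the image of `f` under the connecting map in degree zero: it is represented by
`f̂ i * (f̂ j)⁻¹`, where the `f̂ i` are continuous local lifts of `f`. Since the difference is central,
its two factors commute. -/
def CentralExtension.IsConnecting0 (E : CentralExtension.{u, v, w} Z K) (f : C(X, K))
    (c : CechH1 X Z) : Prop :=
  ∃ (U : PtCover X) (fhat : X → X → E.Ext) (z : Cocycle1 X Z), IsCocycle1 U z.1 ∧
    (∀ i, ContinuousOn (fhat i) (U.set i)) ∧
    (∀ i, ∀ x ∈ U.set i, E.quot (fhat i x) = f x) ∧
    (∀ i j, ∀ x ∈ U.set i ∩ U.set j, E.incl (z.1 i j x) = fhat i x * (fhat j x)⁻¹) ∧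
    c = CechH1.mk z

theorem CentralExtension.exists_isConnecting0 (E : CentralExtension.{u, v, w} Z K)
    (f : C(X, K)) : ∃ c, E.IsConnecting0 f c := by
  have h : ∀ x, ∃ U, IsOpen U ∧ x ∈ U ∧ ∃ s : X → E.Ext, ContinuousOn s U ∧
      ∀ y ∈ U, E.quot (s y) = f y := by
    intro x
    obtain ⟨U, hU, hx, s, hs, hs'⟩ := E.locallyTrivial.exists_section (f x)
    exact ⟨f ⁻¹' U, hU.preimage f.continuous, hx, s ∘ f,
      hs.comp f.continuous.continuousOn fun y hy => hy, fun y hy => hs' _ hy⟩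
  obtain ⟨U, hU⟩ := exists_ptCover h
  choose s hs1 hs2 using hU
  have H : ∀ i j, ∃ g : X → Z, ContinuousOn g (U.set i ∩ U.set j) ∧
      (∀ a ∈ U.set i ∩ U.set j, s i a = s j a * E.incl (g a)) ∧
      ∀ a ∈ U.set i ∩ U.set j, ∀ g', s i a = s j a * E.incl g' → g' = g a := fun i j =>
    E.locallyTrivial.exists_division ((U.isOpen i).inter (U.isOpen j))
      ((hs1 i).mono inter_subset_left) ((hs1 j).mono inter_subset_right)
      fun a ha => by rw [hs2 i a ha.1, hs2 j a ha.2]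
  choose g hg1 hg2 hg3 using H
  have hc : IsCocycle1 U g := by
    refine ⟨hg1, fun i j k x hx => ?_⟩
    refine hg3 i k x ⟨hx.1.1, hx.2⟩ _ ?_
    rw [map_mul, ← mul_assoc, ← hg2 j k x ⟨hx.1.2, hx.2⟩, ← hg2 i j x hx.1]
  refine ⟨_, U, s, ⟨g, U, hc⟩, hc, hs1, hs2, fun i j x hx => ?_, rfl⟩
  rw [hg2 i j x hx, ← E.central]
  group

/-- The image under the connecting map in degree zero does not depend on the choice of lifts. -/
theorem CentralExtension.IsConnecting0.unique {E : CentralExtension.{u, v, w} Z K} {f : C(X, K)}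
    {c c' : CechH1 X Z} (h : E.IsConnecting0 f c) (h' : E.IsConnecting0 f c') : c = c' := by
  obtain ⟨U, s, z, hz, hs1, hs2, hsz, rfl⟩ := h
  obtain ⟨U', s', z', hz', hs1', hs2', hsz', rfl⟩ := h'
  have H : ∀ i, ∃ b : X → Z, ContinuousOn b (U.set i ∩ U'.set i) ∧
      (∀ a ∈ U.set i ∩ U'.set i, s' i a = s i a * E.incl (b a)) ∧
      ∀ a ∈ U.set i ∩ U'.set i, ∀ b', s' i a = s i a * E.incl b' → b' = b a := fun i =>
    E.locallyTrivial.exists_division ((U.isOpen i).inter (U'.isOpen i))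
      ((hs1' i).mono inter_subset_right) ((hs1 i).mono inter_subset_left)
      fun a ha => by rw [hs2' i a ha.2, hs2 i a ha.1]
  choose b hb1 hb2 hb3 using H
  refine Quotient.sound (s := cocycle1Setoid X Z) ⟨U.inter U', b, hb1, fun i j x hx => ?_⟩
  apply E.incl_injective
  have h1 : s i x * E.incl (b i x) * (s j x * E.incl (b j x))⁻¹ =
      s i x * (E.incl (b i x * (b j x)⁻¹) * (s j x)⁻¹) := by
    rw [map_mul, map_inv]; group
  rw [map_mul, map_mul, hsz' i j x ⟨hx.1.2, hx.2.2⟩, hsz i j x ⟨hx.1.1, hx.2.1⟩,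
    hb2 i x hx.1, hb2 j x hx.2, h1, E.central, E.central (b j x)⁻¹, mul_assoc _ (E.incl _),
    ← map_mul, mul_comm (b i x), mul_assoc]

/-- The connecting map `δ₀ : C(X, K) → Ȟ¹(X, Z)`. -/
noncomputable def CentralExtension.δ₀ (E : CentralExtension.{u, v, w} Z K) (f : C(X, K)) :
    CechH1 X Z :=
  (E.exists_isConnecting0 f).choose

/-- `d` is the image of `c` under the connecting map in degree one: `c` is represented by a
cocycle `g` with continuous lifts `ĝ i j`, and `d` is represented by the coboundary of `ĝ`, where the
factors are in the same order as in the cocycle condition `g j k * g i j = g i k`. -/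
def CentralExtension.IsConnecting1 (E : CentralExtension.{u, v, w} Z K) (c : CechH1 X K)
    (d : CechH2 X Z) : Prop :=
  ∃ (U : PtCover X) (g : Cocycle1 X K) (ghat : X → X → X → E.Ext) (z : Cocycle2 X Z),
    IsCocycle1 U g.1 ∧ c = CechH1.mk g ∧
    (∀ i j, ContinuousOn (ghat i j) (U.set i ∩ U.set j)) ∧
    (∀ i j, ∀ x ∈ U.set i ∩ U.set j, E.quot (ghat i j x) = g.1 i j x) ∧
    IsCocycle2 U z.1 ∧
    (∀ i j k, ∀ x ∈ U.set i ∩ U.set j ∩ U.set k,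
      E.incl (z.1 i j k x) = ghat j k x * ghat i j x * (ghat i k x)⁻¹) ∧
    d = CechH2.mk z

/-- On a paracompact Hausdorff space every one-cocycle can be refined to one which lifts. -/
theorem CentralExtension.exists_lift [ParacompactSpace X] [T2Space X]
    (E : CentralExtension.{u, v, w} Z K) (U : PtCover X) (g : X → X → X → K)
    (hg : IsCocycle1 U g) :
    ∃ (W : PtCover X) (r : X → X) (ghat : X → X → X → E.Ext),
      (∀ x, W.set x ⊆ U.set (r x)) ∧
      (∀ i j, ContinuousOn (ghat i j) (W.set i ∩ W.set j)) ∧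
      (∀ i j, ∀ x ∈ W.set i ∩ W.set j, E.quot (ghat i j x) = g (r i) (r j) x) := by
  classical
  obtain ⟨V, hVo, hVc, hVf, hVU⟩ := precise_refinement U.set U.isOpen
    (eq_univ_of_forall fun x => mem_iUnion.mpr ⟨x, U.mem x⟩)
  obtain ⟨V', hVc', hVo', hVV'⟩ := exists_iUnion_eq_closure_subset hVo hVf.point_finite hVc
  have hr : ∀ x, ∃ i, x ∈ V' i := fun x => mem_iUnion.mp (hVc' ▸ mem_univ x)
  choose r hr using hr
  have hsub : ∀ i, V' i ⊆ U.set i := fun i => subset_closure.trans ((hVV' i).trans (hVU i))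
  have h1 : ∀ x j, ∃ W, IsOpen W ∧ x ∈ W ∧ ((W ∩ V' j).Nonempty →
      ∃ l : X → E.Ext, ContinuousOn l W ∧ ∀ y ∈ W, E.quot (l y) = g (r x) j y) := by
    intro x j
    by_cases hx : x ∈ closure (V' j)
    · have hxj : x ∈ U.set (r x) ∩ U.set j := ⟨hsub _ (hr x), hVU j (hVV' j hx)⟩
      obtain ⟨O, hO, hxO, s, hs, hs'⟩ := E.locallyTrivial.exists_section (g (r x) j x)
      refine ⟨(U.set (r x) ∩ U.set j) ∩ g (r x) j ⁻¹' O,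
        (hg.1 (r x) j).isOpen_inter_preimage ((U.isOpen _).inter (U.isOpen _)) hO,
        ⟨hxj, hxO⟩, fun _ => ⟨s ∘ g (r x) j, ?_, fun y hy => hs' _ hy.2⟩⟩
      exact hs.comp ((hg.1 (r x) j).mono inter_subset_left) fun y hy => hy.2
    · refine ⟨(closure (V' j))ᶜ, isClosed_closure.isOpen_compl, hx, ?_⟩
      rintro ⟨y, hy, hy'⟩
      exact absurd (subset_closure hy') hy
  choose N hNo hNx hNl using h1
  have h2 : ∀ x, ∃ W, IsOpen W ∧ x ∈ W ∧ W ⊆ V' (r x) ∧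
      ∀ j, (W ∩ V' j).Nonempty → W ⊆ N x j := by
    intro x
    obtain ⟨t, ht, htf⟩ := hVf x
    refine ⟨interior t ∩ V' (r x) ∩ ⋂ j ∈ {j | (V j ∩ t).Nonempty}, N x j, ?_, ?_, ?_, ?_⟩
    · exact (isOpen_interior.inter (hVo' _)).inter (htf.isOpen_biInter fun j _ => hNo x j)
    · exact ⟨⟨mem_interior_iff_mem_nhds.mpr ht, hr x⟩, mem_iInter₂.mpr fun j _ => hNx x j⟩
    · exact fun y hy => hy.1.2
    · rintro j ⟨y, hy, hyj⟩ a ha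
      exact mem_iInter₂.mp ha.2 j ⟨y, hVV' j (subset_closure hyj), interior_subset hy.1.1⟩
  choose W hWo hWx hWr hWN using h2
  have h3 : ∀ i j, ∃ l : X → E.Ext, ContinuousOn l (W i ∩ W j) ∧
      ∀ x ∈ W i ∩ W j, E.quot (l x) = g (r i) (r j) x := by
    intro i j
    by_cases hne : (W i ∩ W j).Nonempty
    · have hne' : (W i ∩ V' (r j)).Nonempty := hne.mono fun y hy => ⟨hy.1, hWr j hy.2⟩
      have hsubN := hWN i (r j) hne'
      obtain ⟨l, hl, hl'⟩ := hNl i (r j) (hne'.mono fun y hy => ⟨hsubN hy.1, hy.2⟩)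
      exact ⟨l, hl.mono fun y hy => hsubN hy.1, fun y hy => hl' y (hsubN hy.1)⟩
    · rw [not_nonempty_iff_eq_empty] at hne
      exact ⟨fun _ => 1, continuousOn_const, fun x hx => by simp [hne] at hx⟩
  choose ghat hghat1 hghat2 using h3
  exact ⟨⟨W, hWo, hWx⟩, r, ghat, fun x => (hWr x).trans (hsub _), hghat1, hghat2⟩

theorem CentralExtension.exists_isConnecting1 [ParacompactSpace X] [T2Space X]
    (E : CentralExtension.{u, v, w} Z K) (c : CechH1 X K) : ∃ d, E.IsConnecting1 c d := by
  obtain ⟨⟨g, U, hg⟩, rfl⟩ := Quotient.exists_rep c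
  obtain ⟨W, r, s, hWr, hs1, hs2⟩ := E.exists_lift U g hg
  have hg' : IsCocycle1 W fun i j => g (r i) (r j) :=
    ⟨fun i j => (hg.1 _ _).mono (inter_subset_inter (hWr i) (hWr j)),
      fun i j k x hx => hg.2 _ _ _ x ⟨⟨hWr _ hx.1.1, hWr _ hx.1.2⟩, hWr _ hx.2⟩⟩
  have hcoh : Cohomologous1 g fun i j => g (r i) (r j) := by
    refine ⟨U.inter W, fun i => g (r i) i, fun i => ?_, fun i j x hx => ?_⟩
    · exact (hg.1 _ _).mono fun x hx => ⟨hWr i hx.2, hx.1⟩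
    · have h1 := hg.2 (r i) i j x ⟨⟨hWr i hx.1.2, hx.1.1⟩, hx.2.1⟩
      have h2 := hg.2 (r i) (r j) j x ⟨⟨hWr i hx.1.2, hWr j hx.2.2⟩, hx.2.1⟩
      rw [mul_assoc, h1, ← h2]
      group
  have hmul : ∀ i j k, ∀ x ∈ W.set i ∩ W.set j ∩ W.set k,
      E.quot (s j k x * s i j x) = E.quot (s i k x) := by
    intro i j k x hx
    rw [map_mul, hs2 j k x ⟨hx.1.2, hx.2⟩, hs2 i j x hx.1, hs2 i k x ⟨hx.1.1, hx.2⟩]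
    exact hg'.2 i j k x hx
  have H : ∀ i j k, ∃ z : X → Z, ContinuousOn z (W.set i ∩ W.set j ∩ W.set k) ∧
      (∀ a ∈ W.set i ∩ W.set j ∩ W.set k, s j k a * s i j a = s i k a * E.incl (z a)) ∧
      ∀ a ∈ W.set i ∩ W.set j ∩ W.set k, ∀ z',
        s j k a * s i j a = s i k a * E.incl z' → z' = z a := fun i j k =>
    E.locallyTrivial.exists_division (((W.isOpen i).inter (W.isOpen j)).inter (W.isOpen k))
      (s := fun a => s j k a * s i j a) (t := s i k)
      (((hs1 j k).mono fun x hx => ⟨hx.1.2, hx.2⟩).mul ((hs1 i j).mono fun x hx => hx.1))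
      ((hs1 i k).mono fun x hx => ⟨hx.1.1, hx.2⟩) (hmul i j k)
  choose z hz1 hz2 hz3 using H
  have hz : IsCocycle2 W z := by
    refine ⟨hz1, fun i j k l x hx => ?_⟩
    have e1 := hz2 j k l x ⟨⟨hx.1.1.2, hx.1.2⟩, hx.2⟩
    have e2 := hz2 i j l x ⟨hx.1.1, hx.2⟩
    have e3 := hz2 i j k x hx.1
    have e4 := hz2 i k l x ⟨⟨hx.1.1.1, hx.1.2⟩, hx.2⟩
    have e5 : s i l x * E.incl (z i j l x * z j k l x) =
        s i l x * E.incl (z i k l x * z i j k x) := by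
      calc s i l x * E.incl (z i j l x * z j k l x)
          = s j l x * E.incl (z j k l x) * s i j x := by
            rw [map_mul, ← mul_assoc, ← e2, mul_assoc, mul_assoc, E.central]
        _ = s k l x * (s j k x * s i j x) := by rw [← e1, mul_assoc]
        _ = s i l x * E.incl (z i k l x * z i j k x) := by
            rw [e3, ← mul_assoc, e4, map_mul, mul_assoc]
    have e6 := E.incl_injective (mul_left_cancel e5)
    calc z j k l x * (z i k l x)⁻¹ * z i j l x * (z i j k x)⁻¹
        = (z i j l x * z j k l x) * (z i k l x * z i j k x)⁻¹ := by
          rw [mul_inv]; ac_rfl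
      _ = 1 := by rw [e6, mul_inv_cancel]
  refine ⟨_, W, ⟨_, W, hg'⟩, s, ⟨z, W, hz⟩, hg', ?_, hs1, hs2, hz, fun i j k x hx => ?_, rfl⟩
  · exact Quotient.sound (s := cocycle1Setoid X K) hcoh
  · rw [hz2 i j k x hx, ← E.central]
    group

/-- The image under the connecting map in degree one does not depend on any choices. -/
theorem CentralExtension.IsConnecting1.unique {E : CentralExtension.{u, v, w} Z K}
    {c : CechH1 X K} {d d' : CechH2 X Z} (h : E.IsConnecting1 c d) (h' : E.IsConnecting1 c d') :
    d = d' := by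
  obtain ⟨U, g, s, z, hg, rfl, hs1, hs2, hz, hsz, rfl⟩ := h
  obtain ⟨U', g', s', z', hg', hgg', hs1', hs2', hz', hsz', rfl⟩ := h'
  obtain ⟨V, b, hb, hgb⟩ : Cohomologous1 g.1 g'.1 := Quotient.exact (s := cocycle1Setoid X K) hgg'
  have h : ∀ x, ∃ W, IsOpen W ∧ x ∈ W ∧ W ⊆ U.set x ∩ U'.set x ∩ V.set x ∧
      ∃ l : X → E.Ext, ContinuousOn l W ∧ ∀ y ∈ W, E.quot (l y) = b x y := by
    intro x
    obtain ⟨O, hO, hxO, t, ht, ht'⟩ := E.locallyTrivial.exists_section (b x x)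
    refine ⟨(U.set x ∩ U'.set x) ∩ (V.set x ∩ b x ⁻¹' O), ((U.isOpen x).inter (U'.isOpen x)).inter
      ((hb x).isOpen_inter_preimage (V.isOpen x) hO), ⟨⟨U.mem x, U'.mem x⟩, V.mem x, hxO⟩,
      fun y hy => ⟨hy.1, hy.2.1⟩, t ∘ b x, ?_, fun y hy => ht' _ hy.2.2⟩
    exact ht.comp ((hb x).mono fun y hy => hy.2.1) fun y hy => hy.2.2
  obtain ⟨W, hW⟩ := exists_ptCover h
  choose hWs l hl1 hl2 using hW
  have H : ∀ i j, ∃ w : X → Z, ContinuousOn w (W.set i ∩ W.set j) ∧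
      (∀ a ∈ W.set i ∩ W.set j, s' i j a = (l j a)⁻¹ * s i j a * l i a * E.incl (w a)) ∧
      ∀ a ∈ W.set i ∩ W.set j, ∀ w',
        s' i j a = (l j a)⁻¹ * s i j a * l i a * E.incl w' → w' = w a := fun i j =>
    E.locallyTrivial.exists_division ((W.isOpen i).inter (W.isOpen j))
      (s := s' i j) (t := fun a => (l j a)⁻¹ * s i j a * l i a)
      ((hs1' i j).mono fun a ha => ⟨(hWs i ha.1).1.2, (hWs j ha.2).1.2⟩)
      ((((hl1 j).mono inter_subset_right).inv.mul
        ((hs1 i j).mono fun a ha => ⟨(hWs i ha.1).1.1, (hWs j ha.2).1.1⟩)).mul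
        ((hl1 i).mono inter_subset_left))
      fun a ha => by
        rw [hs2' i j a ⟨(hWs i ha.1).1.2, (hWs j ha.2).1.2⟩, map_mul, map_mul, map_inv,
          hs2 i j a ⟨(hWs i ha.1).1.1, (hWs j ha.2).1.1⟩, hl2 i a ha.1, hl2 j a ha.2,
          hgb i j a ⟨(hWs i ha.1).2, (hWs j ha.2).2⟩]
  choose w hw1 hw2 hw3 using H
  refine CechH2.mk_eq_mk ⟨W, w, hw1, fun i j k x hx => ?_⟩
  have e1 := hsz i j k x ⟨⟨(hWs i hx.1.1).1.1, (hWs j hx.1.2).1.1⟩, (hWs k hx.2).1.1⟩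
  have e2 := hsz' i j k x ⟨⟨(hWs i hx.1.1).1.2, (hWs j hx.1.2).1.2⟩, (hWs k hx.2).1.2⟩
  have f1 := hw2 i j x hx.1
  have f2 := hw2 j k x ⟨hx.1.2, hx.2⟩
  have f3 := hw2 i k x ⟨hx.1.1, hx.2⟩
  have e3 : E.incl (z'.1 i j k x) * E.incl (w i k x) =
      E.incl (z.1 i j k x) * (E.incl (w j k x) * E.incl (w i j x)) := by
    have e4 : s' j k x * s' i j x = E.incl (z'.1 i j k x) * s' i k x := by
      rw [e2]; group
    have e5 : s j k x * s i j x = E.incl (z.1 i j k x) * s i k x := by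
      rw [e1]; group
    have e6 : s' j k x * s' i j x = (l k x)⁻¹ * (s j k x * s i j x) * l i x *
        (E.incl (w j k x) * E.incl (w i j x)) := by
      rw [f1, f2, mul_assoc ((l k x)⁻¹ * s j k x * l j x), ← mul_assoc (E.incl (w j k x)),
        E.central (w j k x)]
      group
    rw [e4, e5, f3] at e6
    have e7 : (l k x)⁻¹ * (E.incl (z.1 i j k x) * s i k x) * l i x =
        E.incl (z.1 i j k x) * ((l k x)⁻¹ * s i k x * l i x) := by
      rw [← mul_assoc, ← E.central]; group
    rw [e7, E.central, E.central (z.1 i j k x), mul_assoc, mul_assoc _ (E.incl (z.1 i j k x)),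
      mul_left_cancel_iff] at e6
    rw [E.central]
    exact e6
  rw [← map_mul, ← map_mul, ← map_mul] at e3
  have e8 := E.incl_injective e3
  change (z.1 i j k x)⁻¹ * z'.1 i j k x = _
  rw [eq_mul_inv_of_mul_eq e8, mul_assoc, inv_mul_cancel_left]
  ac_rfl

/-- The connecting map `δ₁ : Ȟ¹(X, K) → Ȟ²(X, Z)` over a paracompact Hausdorff space. -/
noncomputable def CentralExtension.δ₁ [ParacompactSpace X] [T2Space X]
    (E : CentralExtension.{u, v, w} Z K) (c : CechH1 X K) : CechH2 X Z :=
  (E.exists_isConnecting1 c).choose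

end Connecting

/-! ### The pulled back bundle -/

/-- A local trivialization built from a local section and a fibre coordinate. -/
theorem exists_trivialization_of_section {X P G : Type*} [TopologicalSpace X]
    [TopologicalSpace P] [Group G] [TopologicalSpace G] {act : P → G → P} {π : P → X}
    (hπ : Continuous π) (hact : ∀ p g, π (act p g) = π p) {B : Set X} (hB : IsOpen B)
    (σ : X → P) (κ : P → G) (hσ : ∀ x ∈ B, π (σ x) = x)
    (hσc : ContinuousOn (fun q : X × G => act (σ q.1) q.2) (B ×ˢ univ))
    (hκc : ContinuousOn κ (π ⁻¹' B)) (hκ : ∀ x ∈ B, ∀ g, κ (act (σ x) g) = g)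
    (hσκ : ∀ p, π p ∈ B → act (σ (π p)) (κ p) = p)
    (hκg : ∀ p g, π p ∈ B → κ (act p g) = κ p * g) :
    ∃ e : Bundle.Trivialization G π, e.baseSet = B ∧
      ∀ p g, π p ∈ e.baseSet → π (act p g) = π p ∧ (e (act p g)).2 = (e p).2 * g := by
  refine ⟨{ toFun := fun p => (π p, κ p)
            invFun := fun q => act (σ q.1) q.2
            source := π ⁻¹' B
            target := B ×ˢ univ
            map_source' := fun p hp => ⟨hp, mem_univ _⟩
            map_target' := fun q hq => ?_
            left_inv' := fun p hp => hσκ p hp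
            right_inv' := fun q hq => ?_
            open_source := hB.preimage hπ
            open_target := hB.prod isOpen_univ
            continuousOn_toFun := hπ.continuousOn.prodMk hκc
            continuousOn_invFun := hσc
            baseSet := B
            open_baseSet := hB
            source_eq := rfl
            target_eq := rfl
            proj_toFun := fun p hp => rfl }, rfl, fun p g hp => ⟨hact p g, hκg p g hp⟩⟩
  · change π (act (σ q.1) q.2) ∈ B
    rw [hact, hσ _ hq.1]
    exact hq.1
  · refine Prod.ext ?_ (hκ _ hq.1 _)
    change π (act (σ q.1) q.2) = q.1
    rw [hact, hσ _ hq.1]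

section Pullback

variable {X : Type*} [TopologicalSpace X] {Z : Type u} {K : Type v} [CommGroup Z]
  [TopologicalSpace Z] [Group K] [TopologicalSpace K]

theorem CentralExtension.quot_incl (E : CentralExtension.{u, v, w} Z K) (z : Z) :
    E.quot (E.incl z) = 1 := by
  have h : E.incl z ∈ E.incl.range := ⟨z, rfl⟩
  rw [E.range_eq_ker] at h
  exact h

/-- The action of `Z` on the fibre product of `X` and `K̂` over `K`. -/
def CentralExtension.pullbackAct (E : CentralExtension.{u, v, w} Z K) (f : C(X, K))
    (p : {p : X × E.Ext // E.quot p.2 = f p.1}) (z : Z) :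
    {p : X × E.Ext // E.quot p.2 = f p.1} :=
  ⟨(p.1.1, p.1.2 * E.incl z), by rw [map_mul, E.quot_incl, mul_one]; exact p.2⟩

/-- The principal `Z`-bundle `f^* K̂` over `X`. -/
def CentralExtension.pullback [IsTopologicalGroup Z] (E : CentralExtension.{u, v, w} Z K)
    (f : C(X, K)) : PrincipalBundle X Z where
  Total := {p : X × E.Ext // E.quot p.2 = f p.1}
  act := E.pullbackAct f
  act_one p := by simp [pullbackAct]
  act_mul p z w := by simp [pullbackAct, mul_assoc]
  proj p := p.1.1
  isPrincipal := by
    intro x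
    obtain ⟨e, hx, he⟩ := E.locallyTrivial (f x)
    classical
    obtain ⟨s, hs⟩ : ∃ s : X → E.Ext, ∀ y, E.quot (s y) = f y ∧
        (f y ∈ e.baseSet → s y = e.toOpenPartialHomeomorph.symm (f y, 1)) := by
      refine ⟨fun y => if f y ∈ e.baseSet then e.toOpenPartialHomeomorph.symm (f y, 1)
        else (E.quot_surjective (f y)).choose, fun y => ?_⟩
      by_cases hy : f y ∈ e.baseSet
      · simp only [hy, if_true, true_implies, and_true]
        exact e.proj_symm_apply' hy
      · simp only [hy, if_false, false_implies, and_true]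
        exact (E.quot_surjective (f y)).choose_spec
    have hsc : ContinuousOn s (f ⁻¹' e.baseSet) := by
      have h : ContinuousOn (fun y => e.toOpenPartialHomeomorph.symm (f y, 1))
          (f ⁻¹' e.baseSet) := by
        refine e.continuousOn_invFun.comp (by fun_prop) fun y hy => ?_
        simpa [e.target_eq] using hy
      exact h.congr fun y hy => (hs y).2 hy
    have hes : ∀ y, f y ∈ e.baseSet → (e (s y)).2 = 1 := by
      intro y hy
      rw [(hs y).2 hy]
      exact congrArg Prod.snd (e.apply_symm_apply' hy)
    refine Exists.elim (exists_trivialization_of_section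
      (act := E.pullbackAct f)
      (π := fun p => p.1.1) (by fun_prop) (fun _ _ => rfl)
      (e.open_baseSet.preimage f.continuous) (fun y => ⟨(y, s y), (hs y).1⟩)
      (fun p => (e p.1.2).2) (fun _ _ => rfl) ?_ ?_ ?_ ?_ ?_)
      fun e' h => ⟨e', h.1 ▸ hx, h.2⟩
    · refine (Topology.IsInducing.subtypeVal.continuousOn_iff).mpr ?_
      refine ContinuousOn.prodMk continuousOn_fst (ContinuousOn.mul ?_ ?_)
      · exact hsc.comp continuousOn_fst fun q hq => hq.1
      · exact E.continuous_incl.comp_continuousOn continuousOn_snd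
    · refine continuousOn_snd.comp
        (t := univ) (e.continuousOn_toFun.comp
          (by fun_prop : Continuous fun p : {p : X × E.Ext // E.quot p.2 = f p.1} =>
            p.1.2).continuousOn fun p hp => ?_) fun _ _ => mem_univ _
      rw [e.source_eq]
      change E.quot p.1.2 ∈ e.baseSet
      rw [p.2]
      exact hp
    · intro y hy z
      change (e (s y * E.incl z)).2 = z
      rw [(he (s y) z (by rw [(hs y).1]; exact hy)).2, hes y hy, one_mul]
    · rintro ⟨⟨y, a⟩, ha⟩ hy
      refine Subtype.ext (Prod.ext rfl ?_)
      change s y * E.incl (e a).2 = a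
      have hy' : E.quot (s y) ∈ e.baseSet := by rw [(hs y).1]; exact hy
      have h := he (s y) (e a).2 hy'
      have ha1 : a ∈ e.source := by rw [e.mem_source, ha]; exact hy
      have ha2 : s y * E.incl (e a).2 ∈ e.source := by rw [e.mem_source, h.1]; exact hy'
      refine e.injOn ha2 ha1 (Prod.ext ?_ ?_)
      · change (e (s y * E.incl (e a).2)).1 = (e a).1
        rw [e.coe_fst ha2, e.coe_fst ha1, h.1, (hs y).1, ha]
      · change (e (s y * E.incl (e a).2)).2 = (e a).2
        rw [h.2, hes y hy, one_mul]
    · rintro ⟨⟨y, a⟩, ha⟩ z hy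
      exact (he a z (by rw [ha]; exact hy)).2

end Pullback

/-! ### Spheres as boundaries of simplices -/

/-- The sphere of dimension `n`, realized as the boundary of the standard simplex with vertices
`e₀, …, eₙ₊₁`. -/
abbrev SimplexSphere (n : ℕ) : Type :=
  {x : Fin (n + 2) → ℝ // x ∈ stdSimplex ℝ (Fin (n + 2)) ∧ ∃ i, x i = 0}

namespace SimplexSphere

theorem continuous_coord {n : ℕ} (i : Fin (n + 2)) :
    Continuous fun y : SimplexSphere n => y.1 i :=
  (continuous_apply i).comp continuous_subtype_val

instance (n : ℕ) : CompactSpace (SimplexSphere n) := by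
  have h : IsClosed {x : Fin (n + 2) → ℝ | ∃ i, x i = 0} := by
    rw [ofPred_exists]
    exact isClosed_iUnion_of_finite fun i => isClosed_eq (continuous_apply i) continuous_const
  exact isCompact_iff_compactSpace.mp ((isCompact_stdSimplex ℝ (Fin (n + 2))).inter_right h)

/-- The vertex `e₀`. -/
instance (n : ℕ) : Inhabited (SimplexSphere n) :=
  ⟨⟨Pi.single 0 1, single_mem_stdSimplex ℝ 0, 1, by simp⟩⟩

variable {n : ℕ}

/-- The last barycentric coordinate. -/
def height (y : SimplexSphere (n + 1)) : ℝ := y.1 (Fin.last (n + 2))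

theorem continuous_height : Continuous (height (n := n)) := continuous_coord _

/-- The union of the faces which contain the last vertex. -/
def cone (n : ℕ) : Set (SimplexSphere (n + 1)) := {y | ∃ i : Fin (n + 2), y.1 i.castSucc = 0}

/-- The face opposite to the last vertex. -/
def face (n : ℕ) : Set (SimplexSphere (n + 1)) := {y | height y = 0}

theorem isClosed_cone : IsClosed (cone n) := by
  rw [cone, ofPred_exists]
  exact isClosed_iUnion_of_finite fun i => isClosed_eq (continuous_coord _) continuous_const

theorem isClosed_face : IsClosed (face n) := isClosed_eq continuous_height continuous_const

theorem cone_union_face (y : SimplexSphere (n + 1)) : y ∈ cone n ∨ y ∈ face n := by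
  obtain ⟨i, hi⟩ := y.2.2
  induction i using Fin.lastCases with
  | last => exact Or.inr hi
  | cast i => exact Or.inl ⟨i, hi⟩

theorem height_nonneg (y : SimplexSphere (n + 1)) : 0 ≤ height y := y.2.1.1 _

theorem height_le_one (y : SimplexSphere (n + 1)) : height y ≤ 1 :=
  (mem_Icc_of_mem_stdSimplex y.2.1 _).2

theorem mem_cone_of_height_pos {y : SimplexSphere (n + 1)} (h : 0 < height y) : y ∈ cone n :=
  (cone_union_face y).resolve_right h.ne'

/-- The identification of the sphere of dimension `n` with the equator, that is, with the
boundary of the last face. -/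
def equator (x : SimplexSphere n) : SimplexSphere (n + 1) :=
  ⟨Fin.snoc (α := fun _ => ℝ) x.1 0, by
    refine ⟨⟨fun i => ?_, ?_⟩, Fin.last _, by simp⟩
    · induction i using Fin.lastCases with
      | last => simp
      | cast i => simpa using x.2.1.1 i
    · rw [Fin.sum_univ_castSucc]
      simpa using x.2.1.2⟩

theorem equator_mem_face (x : SimplexSphere n) : equator x ∈ face n := by
  simp [face, height, equator]

theorem equator_mem_cone (x : SimplexSphere n) : equator x ∈ cone n := by
  obtain ⟨i, hi⟩ := x.2.2
  exact ⟨i, by simpa [equator] using hi⟩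

theorem height_equator (x : SimplexSphere n) : height (equator x) = 0 := equator_mem_face x

open Classical in
/-- The radial retraction from the last vertex `e`, from the cone without `e` onto the equator.
Outside of its domain it has a junk value. -/
noncomputable def retract (y : SimplexSphere (n + 1)) : SimplexSphere n :=
  if h : y ∈ cone n ∧ height y ≠ 1 then
    ⟨fun i => y.1 i.castSucc / (1 - height y), by
      have h1 : 0 < 1 - height y := sub_pos.mpr (lt_of_le_of_ne (height_le_one y) h.2)
      refine ⟨⟨fun i => div_nonneg (y.2.1.1 _) h1.le, ?_⟩, ?_⟩
      · rw [← Finset.sum_div, div_eq_one_iff_eq h1.ne', eq_sub_iff_add_eq]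
        have := y.2.1.2
        rwa [Fin.sum_univ_castSucc] at this
      · obtain ⟨i, hi⟩ := h.1
        exact ⟨i, by simp [hi]⟩⟩
  else default

theorem retract_coord {y : SimplexSphere (n + 1)} (h : y ∈ cone n) (h' : height y ≠ 1)
    (i : Fin (n + 2)) : (retract y).1 i = y.1 i.castSucc / (1 - height y) := by
  rw [retract, dif_pos ⟨h, h'⟩]

theorem continuousOn_retract : ContinuousOn (retract (n := n)) (cone n ∩ {y | height y ≠ 1}) := by
  refine (Topology.IsInducing.subtypeVal.continuousOn_iff).mpr ?_
  refine continuousOn_pi.mpr fun i => ?_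
  have h : ContinuousOn (fun y : SimplexSphere (n + 1) => y.1 i.castSucc / (1 - height y))
      (cone n ∩ {y | height y ≠ 1}) :=
    (continuous_coord _).continuousOn.div
      (continuous_const.sub continuous_height).continuousOn
      fun y hy => sub_ne_zero.mpr (Ne.symm hy.2)
  exact h.congr fun y hy => retract_coord hy.1 hy.2 i

theorem retract_equator (x : SimplexSphere n) : retract (equator x) = x := by
  refine Subtype.ext (funext fun i => ?_)
  rw [retract_coord (equator_mem_cone x) (by simp [height_equator]), height_equator]
  simp [equator]

theorem equator_retract {y : SimplexSphere (n + 1)} (h : y ∈ cone n) (h' : y ∈ face n) :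
    equator (retract y) = y := by
  have h0 : height y = 0 := h'
  refine Subtype.ext (funext fun i => ?_)
  induction i using Fin.lastCases with
  | last => simpa [equator, height] using h0.symm
  | cast i => simp [equator, retract_coord h (by simp [h0]) i, h0]

/-! ### The suspension maps

A cover `(U a)` of the sphere induces a cover of the sphere in the next dimension which has one
more index, `none`. When the `U a` are the sets `{x | 0 < x i}`, it consists again of the sets
`{y | 0 < y i}`, with `none` corresponding to the last index. -/

/-- The sets of the suspended cover: `none` gives the star of the last vertex, and `some a` gives
the interior of the last face together with the preimage of `U a` under the retraction. -/
def suspSet (U : SimplexSphere n → Set (SimplexSphere n)) :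
    Option (SimplexSphere n) → Set (SimplexSphere (n + 1))
  | none => {y | 0 < height y}
  | some a => {y | height y ≠ 1 ∧ (y ∈ cone n → retract y ∈ U a)}

open Classical in
/-- For each point an index such that the corresponding set of the suspended cover contains it. -/
noncomputable def suspIndex (y : SimplexSphere (n + 1)) : Option (SimplexSphere n) :=
  if 0 < height y then none else some (retract y)

theorem isOpen_suspSet (U : PtCover (SimplexSphere n)) (i : Option (SimplexSphere n)) :
    IsOpen (suspSet U.set i) := by
  cases i with
  | none => exact isOpen_lt continuous_const continuous_height
  | some a =>
    have h1 : IsOpen {y : SimplexSphere (n + 1) | height y ≠ 1} :=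
      isOpen_ne_fun continuous_height continuous_const
    rw [isOpen_iff_mem_nhds]
    rintro y ⟨hy1, hy2⟩
    by_cases hy : y ∈ cone n
    · have h2 := continuousOn_retract y ⟨hy, hy1⟩ |>.preimage_mem_nhdsWithin
        ((U.isOpen a).mem_nhds (hy2 hy))
      rw [mem_nhdsWithin_iff_eventually] at h2
      filter_upwards [h2, h1.mem_nhds hy1] with z hz hz1
      exact ⟨hz1, fun hzc => hz ⟨hzc, hz1⟩⟩
    · filter_upwards [h1.mem_nhds hy1, isClosed_cone.isOpen_compl.mem_nhds hy] with z hz hz'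
      exact ⟨hz, fun h => absurd h hz'⟩

/-- The suspended cover, indexed by points. -/
noncomputable def suspCover (U : PtCover (SimplexSphere n)) : PtCover (SimplexSphere (n + 1)) where
  set y := suspSet U.set (suspIndex y)
  isOpen _ := isOpen_suspSet U _
  mem y := by
    by_cases hy : 0 < height y
    · simp [suspIndex, hy, suspSet]
    · have h0 : height y = 0 := le_antisymm (not_lt.mp hy) (height_nonneg y)
      simp only [suspIndex, hy, if_false]
      exact ⟨by simp [h0], fun _ => U.mem _⟩

/-- The suspension of a zero-cochain: `g i ∘ p` at the indices `(i, none)`, extended to be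
antisymmetric, and trivial when `none` does not occur. -/
noncomputable def suspCochain0 {G : Type*} [Group G] (g : SimplexSphere n → SimplexSphere n → G) :
    Option (SimplexSphere n) → Option (SimplexSphere n) → SimplexSphere (n + 1) → G
  | some a, none => fun y => g a (retract y)
  | none, some a => fun y => (g a (retract y))⁻¹
  | _, _ => fun _ => 1

/-- The suspension of a one-cochain: `g i j ∘ p` at the indices `(i, j, none)`, extended to be
antisymmetric in the position of `none`, and trivial when `none` does not occur exactly once. -/
noncomputable def suspCochain1 {Z : Type*} [CommGroup Z]
    (g : SimplexSphere n → SimplexSphere n → SimplexSphere n → Z) :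
    Option (SimplexSphere n) → Option (SimplexSphere n) → Option (SimplexSphere n) →
      SimplexSphere (n + 1) → Z
  | some a, some b, none => fun y => g a b (retract y)
  | some a, none, some b => fun y => (g a b (retract y))⁻¹
  | none, some a, some b => fun y => g a b (retract y)
  | _, _, _ => fun _ => 1

theorem retract_mem {U : SimplexSphere n → Set (SimplexSphere n)} {a : SimplexSphere n}
    {y : SimplexSphere (n + 1)} (h : 0 < height y) (hy : y ∈ suspSet U (some a)) :
    retract y ∈ U a := hy.2 (mem_cone_of_height_pos h)

theorem continuousOn_comp_retract {G : Type*} [TopologicalSpace G] {g : SimplexSphere n → G}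
    {A : Set (SimplexSphere n)} (hg : ContinuousOn g A) {B : Set (SimplexSphere (n + 1))}
    (hB : ∀ y ∈ B, 0 < height y ∧ height y ≠ 1 ∧ retract y ∈ A) :
    ContinuousOn (fun y => g (retract y)) B :=
  hg.comp (continuousOn_retract.mono fun y hy =>
    ⟨mem_cone_of_height_pos (hB y hy).1, (hB y hy).2.1⟩) fun y hy => (hB y hy).2.2

theorem continuousOn_suspCochain0 {G : Type*} [Group G] [TopologicalSpace G]
    [IsTopologicalGroup G] {U : PtCover (SimplexSphere n)}
    {g : SimplexSphere n → SimplexSphere n → G} (hg : ∀ i, ContinuousOn (g i) (U.set i))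
    (i j : Option (SimplexSphere n)) :
    ContinuousOn (suspCochain0 g i j) (suspSet U.set i ∩ suspSet U.set j) := by
  rcases i with _ | a <;> rcases j with _ | b
  · exact continuousOn_const
  · exact (continuousOn_comp_retract (hg b) fun y hy =>
      ⟨hy.1, hy.2.1, retract_mem hy.1 hy.2⟩).inv
  · exact continuousOn_comp_retract (hg a) fun y hy =>
      ⟨hy.2, hy.1.1, retract_mem hy.2 hy.1⟩
  · exact continuousOn_const

theorem continuousOn_suspCochain1 {Z : Type*} [CommGroup Z] [TopologicalSpace Z]
    [IsTopologicalGroup Z] {U : PtCover (SimplexSphere n)}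
    {g : SimplexSphere n → SimplexSphere n → SimplexSphere n → Z}
    (hg : ∀ i j, ContinuousOn (g i j) (U.set i ∩ U.set j)) (i j k : Option (SimplexSphere n)) :
    ContinuousOn (suspCochain1 g i j k)
      (suspSet U.set i ∩ suspSet U.set j ∩ suspSet U.set k) := by
  rcases i with _ | a <;> rcases j with _ | b <;> rcases k with _ | c
  · exact continuousOn_const
  · exact continuousOn_const
  · exact continuousOn_const
  · exact continuousOn_comp_retract (hg b c) fun y hy =>
      ⟨hy.1.1, hy.2.1, retract_mem hy.1.1 hy.1.2, retract_mem hy.1.1 hy.2⟩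
  · exact continuousOn_const
  · exact (continuousOn_comp_retract (hg a c) fun y hy =>
      ⟨hy.1.2, hy.2.1, retract_mem hy.1.2 hy.1.1, retract_mem hy.1.2 hy.2⟩).inv
  · exact continuousOn_comp_retract (hg a b) fun y hy =>
      ⟨hy.2, hy.1.1.1, retract_mem hy.2 hy.1.1, retract_mem hy.2 hy.1.2⟩
  · exact continuousOn_const

theorem suspCochain0_mul {K : Type*} [Group K] (f : SimplexSphere n → K)
    (i j k : Option (SimplexSphere n)) (y : SimplexSphere (n + 1)) :
    suspCochain0 (fun _ => f) j k y * suspCochain0 (fun _ => f) i j y =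
      suspCochain0 (fun _ => f) i k y := by
  rcases i with _ | a <;> rcases j with _ | b <;> rcases k with _ | c <;> simp [suspCochain0]

theorem suspCochain1_mul {Z : Type*} [CommGroup Z] [TopologicalSpace Z]
    {U : PtCover (SimplexSphere n)}
    {g : SimplexSphere n → SimplexSphere n → SimplexSphere n → Z} (hg : IsCocycle1 U g)
    (i j k l : Option (SimplexSphere n)) (y : SimplexSphere (n + 1))
    (hy : y ∈ suspSet U.set i ∩ suspSet U.set j ∩ suspSet U.set k ∩ suspSet U.set l) :
    suspCochain1 g j k l y * (suspCochain1 g i k l y)⁻¹ * suspCochain1 g i j l y *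
      (suspCochain1 g i j k y)⁻¹ = 1 := by
  rcases i with _ | a <;> rcases j with _ | b <;> rcases k with _ | c <;> rcases l with _ | d
  case some.some.some.none =>
    have h := hg.2 a b c _ ⟨⟨retract_mem hy.2 hy.1.1.1, retract_mem hy.2 hy.1.1.2⟩,
      retract_mem hy.2 hy.1.2⟩
    simp [suspCochain1, ← h]
  case some.some.none.some =>
    have h := hg.2 a b d _ ⟨⟨retract_mem hy.1.2 hy.1.1.1, retract_mem hy.1.2 hy.1.1.2⟩,
      retract_mem hy.1.2 hy.2⟩
    simp [suspCochain1, ← h]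
  case some.none.some.some =>
    have h := hg.2 a c d _ ⟨⟨retract_mem hy.1.1.2 hy.1.1.1, retract_mem hy.1.1.2 hy.1.2⟩,
      retract_mem hy.1.1.2 hy.2⟩
    simp [suspCochain1, ← h]
  case none.some.some.some =>
    have h := hg.2 b c d _ ⟨⟨retract_mem hy.1.1.1 hy.1.1.2, retract_mem hy.1.1.1 hy.1.2⟩,
      retract_mem hy.1.1.1 hy.2⟩
    simp [suspCochain1, ← h]
  all_goals simp [suspCochain1]

/-- Cohomologous one-cocycles have suspensions which differ by a coboundary. -/
theorem suspCochain1_coboundary {Z : Type*} [CommGroup Z]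
    {U : PtCover (SimplexSphere n)}
    {g h : SimplexSphere n → SimplexSphere n → SimplexSphere n → Z}
    {b : SimplexSphere n → SimplexSphere n → Z}
    (hgh : ∀ i j, ∀ x ∈ U.set i ∩ U.set j, h i j x = (b j x)⁻¹ * g i j x * b i x)
    (i j k : Option (SimplexSphere n)) (y : SimplexSphere (n + 1))
    (hy : y ∈ suspSet U.set i ∩ suspSet U.set j ∩ suspSet U.set k) :
    (suspCochain1 g i j k y)⁻¹ * suspCochain1 h i j k y =
      (suspCochain0 b j k y)⁻¹ * ((suspCochain0 b i k y)⁻¹)⁻¹ * (suspCochain0 b i j y)⁻¹ := by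
  have comm : ∀ p q r : Z, q⁻¹ * (p⁻¹ * q * r) = p⁻¹ * r := fun p q r => by
    rw [mul_comm p⁻¹ q, mul_assoc q, inv_mul_cancel_left]
  rcases i with _ | i' <;> rcases j with _ | j' <;> rcases k with _ | k'
  case some.some.none =>
    have h := hgh i' j' _ ⟨retract_mem hy.2 hy.1.1, retract_mem hy.2 hy.1.2⟩
    simp [suspCochain1, suspCochain0, h, comm]
  case some.none.some =>
    have h := hgh i' k' _ ⟨retract_mem hy.1.2 hy.1.1, retract_mem hy.1.2 hy.2⟩
    simp only [suspCochain1, suspCochain0, h, inv_inv, mul_one]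
    rw [← inv_inj]
    simp only [mul_inv, inv_inv]
    simpa using comm (b k' (retract y)) (g i' k' (retract y)) (b i' (retract y))
  case none.some.some =>
    have h := hgh j' k' _ ⟨retract_mem hy.1.1 hy.1.2, retract_mem hy.1.1 hy.2⟩
    simp only [suspCochain1, suspCochain0, h, comm, inv_inv, inv_one, one_mul]
  all_goals simp [suspCochain1, suspCochain0]

/-- The suspension of a continuous map, as a one-cocycle. -/
noncomputable def suspCocycle0 {K : Type*} [Group K] [TopologicalSpace K] [IsTopologicalGroup K]
    (f : C(SimplexSphere n, K)) : Cocycle1 (SimplexSphere (n + 1)) K :=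
  ⟨fun i j => suspCochain0 (fun _ => f) (suspIndex i) (suspIndex j),
    suspCover ⟨fun _ => univ, fun _ => isOpen_univ, fun _ => mem_univ _⟩,
    fun _ _ => continuousOn_suspCochain0 (fun _ => f.continuous.continuousOn) _ _,
    fun _ _ _ _ _ => suspCochain0_mul _ _ _ _ _⟩

/-- The suspension map from `C(Sⁿ, K)` to the first cohomology of the next sphere. -/
noncomputable def susp₀ {K : Type*} [Group K] [TopologicalSpace K] [IsTopologicalGroup K]
    (f : C(SimplexSphere n, K)) : CechH1 (SimplexSphere (n + 1)) K :=
  CechH1.mk (suspCocycle0 f)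

section

variable {Z : Type*} [CommGroup Z] [TopologicalSpace Z] [IsTopologicalGroup Z]

/-- The suspension of a one-cocycle, as a two-cocycle. -/
noncomputable def suspCocycle1 (g : Cocycle1 (SimplexSphere n) Z) :
    Cocycle2 (SimplexSphere (n + 1)) Z :=
  ⟨fun i j k => suspCochain1 g.1 (suspIndex i) (suspIndex j) (suspIndex k), by
    obtain ⟨g, U, hg⟩ := g
    exact ⟨suspCover U, fun i j k => continuousOn_suspCochain1 hg.1 _ _ _,
      fun i j k l y hy => suspCochain1_mul hg _ _ _ _ y hy⟩⟩

/-- The suspension map in degree one. -/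
noncomputable def susp₁ (c : CechH1 (SimplexSphere n) Z) : CechH2 (SimplexSphere (n + 1)) Z :=
  Quotient.lift (s := cocycle1Setoid (SimplexSphere n) Z)
    (fun g => CechH2.mk (suspCocycle1 g)) (by
      rintro g h ⟨U, b, hb, hgh⟩
      exact CechH2.mk_eq_mk ⟨suspCover U,
        fun i j y => (suspCochain0 b (suspIndex i) (suspIndex j) y)⁻¹,
        fun i j => (continuousOn_suspCochain0 hb _ _).inv,
        fun i j k y hy => suspCochain1_coboundary hgh _ _ _ y hy⟩) c

end

/-! ### The clutched bundle -/

section Clutching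

variable {K : Type v} [Group K]

/-- The gluing relation of the clutching construction: over a point `x` of the equator, the
point `(x, 0, f x * k)` over the cone is identified with `(x, 1, k)` over the last face. -/
inductive ClutchRel (f : SimplexSphere n → K) :
    (cone n × K) ⊕ (face n × K) → (cone n × K) ⊕ (face n × K) → Prop
  | glue (x : SimplexSphere n) (k : K) :
      ClutchRel f (Sum.inl (⟨equator x, equator_mem_cone x⟩, f x * k))
        (Sum.inr (⟨equator x, equator_mem_face x⟩, k))

/-- The total space of the clutched bundle, a quotient of the disjoint union of the trivial
bundles over the two discs `cone n` and `face n`. -/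
def ClutchSpace (f : SimplexSphere n → K) : Type v := Quot (ClutchRel f)

variable (f : SimplexSphere n → K)

instance [TopologicalSpace K] : TopologicalSpace (ClutchSpace f) :=
  inferInstanceAs (TopologicalSpace (Quot (ClutchRel f)))

variable {f}

/-- The quotient map onto the clutched bundle. -/
def ClutchSpace.mk (p : (cone n × K) ⊕ (face n × K)) : ClutchSpace f := Quot.mk _ p

theorem ClutchSpace.isQuotientMap_mk [TopologicalSpace K] :
    IsQuotientMap (ClutchSpace.mk (f := f)) := isQuotientMap_quot_mk

theorem ClutchSpace.glue (x : SimplexSphere n) (k : K) :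
    ClutchSpace.mk (f := f) (Sum.inl (⟨equator x, equator_mem_cone x⟩, f x * k)) =
      ClutchSpace.mk (Sum.inr (⟨equator x, equator_mem_face x⟩, k)) :=
  Quot.sound (ClutchRel.glue x k)

/-- The projection of the clutched bundle. -/
def ClutchSpace.proj : ClutchSpace f → SimplexSphere (n + 1) :=
  Quot.lift (Sum.elim (fun p => p.1.1) (fun p => p.1.1)) (by rintro _ _ ⟨x, k⟩; rfl)

/-- The action of `K` from the right on the clutched bundle. -/
def ClutchSpace.act (p : ClutchSpace f) (g : K) : ClutchSpace f :=
  Quot.map (Sum.map (fun p => (p.1, p.2 * g)) (fun p => (p.1, p.2 * g)))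
    (by
      rintro _ _ ⟨x, k⟩
      simp only [Sum.map_inl, Sum.map_inr, mul_assoc]
      exact ClutchRel.glue x _) p

/-- The fibre coordinate over the star of the last vertex. -/
noncomputable def ClutchSpace.coordCone : ClutchSpace f → K :=
  Quot.lift (Sum.elim (fun p => p.2) (fun p => f (retract p.1.1) * p.2))
    (by rintro _ _ ⟨x, k⟩; simp [retract_equator])

/-- The fibre coordinate over the complement of the last vertex. -/
noncomputable def ClutchSpace.coordFace : ClutchSpace f → K :=
  Quot.lift (Sum.elim (fun p => (f (retract p.1.1))⁻¹ * p.2) (fun p => p.2))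
    (by rintro _ _ ⟨x, k⟩; simp [retract_equator])

theorem ClutchSpace.proj_act (p : ClutchSpace f) (g : K) :
    (p.act g).proj = p.proj := by
  rcases p with ⟨p | p⟩ <;> rfl

theorem ClutchSpace.coordCone_act (p : ClutchSpace f) (g : K) :
    (p.act g).coordCone = p.coordCone * g := by
  rcases p with ⟨p | p⟩
  · rfl
  · exact (mul_assoc _ _ _).symm

theorem ClutchSpace.coordFace_act (p : ClutchSpace f) (g : K) :
    (p.act g).coordFace = p.coordFace * g := by
  rcases p with ⟨p | p⟩
  · exact (mul_assoc _ _ _).symm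
  · rfl

open Classical in
/-- A section over the cone. -/
noncomputable def ClutchSpace.sectionCone (f : SimplexSphere n → K)
    (y : SimplexSphere (n + 1)) : ClutchSpace f :=
  if h : y ∈ cone n then mk (Sum.inl (⟨y, h⟩, 1))
  else mk (Sum.inr (⟨y, (cone_union_face y).resolve_left h⟩, 1))

open Classical in
/-- A section over the complement of the last vertex. -/
noncomputable def ClutchSpace.sectionFace (f : SimplexSphere n → K)
    (y : SimplexSphere (n + 1)) : ClutchSpace f :=
  if h : y ∈ face n then mk (Sum.inr (⟨y, h⟩, 1))
  else mk (Sum.inl (⟨y, (cone_union_face y).resolve_right h⟩, f (retract y)))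

theorem ClutchSpace.proj_sectionCone (y : SimplexSphere (n + 1)) :
    (sectionCone f y).proj = y := by
  unfold sectionCone
  split_ifs <;> rfl

theorem ClutchSpace.proj_sectionFace (y : SimplexSphere (n + 1)) :
    (sectionFace f y).proj = y := by
  unfold sectionFace
  split_ifs <;> rfl

theorem ClutchSpace.mk_inl_eq {y : SimplexSphere (n + 1)} (h : y ∈ cone n) (k : K) :
    mk (f := f) (Sum.inl (⟨y, h⟩, k)) = (sectionCone f y).act k := by
  rw [sectionCone, dif_pos h]
  change _ = mk (Sum.inl (⟨y, h⟩, 1 * k))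
  rw [one_mul]

theorem ClutchSpace.mk_inr_eq {y : SimplexSphere (n + 1)} (h : y ∈ face n) (k : K) :
    mk (f := f) (Sum.inr (⟨y, h⟩, k)) = (sectionFace f y).act k := by
  rw [sectionFace, dif_pos h]
  change _ = mk (Sum.inr (⟨y, h⟩, 1 * k))
  rw [one_mul]

theorem ClutchSpace.mk_inl_eq' {y : SimplexSphere (n + 1)} (h : y ∈ cone n) (k : K) :
    mk (f := f) (Sum.inl (⟨y, h⟩, f (retract y) * k)) = (sectionFace f y).act k := by
  by_cases h' : y ∈ face n
  · rw [← mk_inr_eq h']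
    have h1 := glue (f := f) (retract y) k
    simp only [equator_retract h h'] at h1
    exact h1
  · rw [sectionFace, dif_neg h']
    rfl

variable [TopologicalSpace K] [IsTopologicalGroup K]

theorem ClutchSpace.continuous_proj : Continuous (proj (f := f)) :=
  continuous_quot_lift _ (by fun_prop)

theorem ClutchSpace.continuousOn_sectionCone (f : C(SimplexSphere n, K)) :
    ContinuousOn (fun q : SimplexSphere (n + 1) × K => (sectionCone f q.1).act q.2)
      ({y | 0 < height y} ×ˢ univ) := by
  rw [continuousOn_iff_continuous_domRestrict]
  have h : Continuous fun q : ({y : SimplexSphere (n + 1) | 0 < height y} ×ˢ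
      (univ : Set K) : Set _) => ClutchSpace.mk (f := f)
        (Sum.inl (⟨q.1.1, mem_cone_of_height_pos q.2.1⟩, q.1.2)) :=
    ClutchSpace.isQuotientMap_mk.continuous.comp (by fun_prop)
  refine h.congr fun q => ?_
  exact ClutchSpace.mk_inl_eq _ _

theorem ClutchSpace.continuousOn_sectionFace (f : C(SimplexSphere n, K)) :
    ContinuousOn (fun q : SimplexSphere (n + 1) × K => (sectionFace f q.1).act q.2)
      ({y | height y ≠ 1} ×ˢ univ) := by
  have h1 : ContinuousOn (fun q : SimplexSphere (n + 1) × K =>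
      (ClutchSpace.sectionFace f q.1).act q.2)
      (({y | height y ≠ 1} ×ˢ univ) ∩ (Prod.fst ⁻¹' cone n)) := by
    rw [continuousOn_iff_continuous_domRestrict]
    have hr : Continuous fun q : (({y | height y ≠ 1} ×ˢ univ) ∩
        (Prod.fst ⁻¹' cone n) : Set (SimplexSphere (n + 1) × K)) => retract q.1.1 :=
      continuousOn_retract.comp_continuous (by fun_prop) fun q => ⟨q.2.2, q.2.1.1⟩
    have h : Continuous fun q : (({y | height y ≠ 1} ×ˢ univ) ∩
        (Prod.fst ⁻¹' cone n) : Set (SimplexSphere (n + 1) × K)) =>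
        ClutchSpace.mk (f := f)
          (Sum.inl (⟨q.1.1, q.2.2⟩, f (retract q.1.1) * q.1.2)) :=
      ClutchSpace.isQuotientMap_mk.continuous.comp (by fun_prop)
    exact h.congr fun q => ClutchSpace.mk_inl_eq' _ _
  have h2 : ContinuousOn (fun q : SimplexSphere (n + 1) × K =>
      (ClutchSpace.sectionFace f q.1).act q.2)
      (({y | height y ≠ 1} ×ˢ univ) ∩ (Prod.fst ⁻¹' face n)) := by
    rw [continuousOn_iff_continuous_domRestrict]
    have h : Continuous fun q : (({y | height y ≠ 1} ×ˢ univ) ∩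
        (Prod.fst ⁻¹' face n) : Set (SimplexSphere (n + 1) × K)) =>
        ClutchSpace.mk (f := f) (Sum.inr (⟨q.1.1, q.2.2⟩, q.1.2)) :=
      ClutchSpace.isQuotientMap_mk.continuous.comp (by fun_prop)
    exact h.congr fun q => ClutchSpace.mk_inr_eq _ _
  intro q hq
  have hc : IsClosed (Prod.fst ⁻¹' cone n : Set (SimplexSphere (n + 1) × K)) :=
    isClosed_cone.preimage continuous_fst
  have hf : IsClosed (Prod.fst ⁻¹' face n : Set (SimplexSphere (n + 1) × K)) :=
    isClosed_face.preimage continuous_fst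
  have key : ∀ C : Set (SimplexSphere (n + 1) × K), IsClosed C →
      ContinuousOn (fun q : SimplexSphere (n + 1) × K =>
        (ClutchSpace.sectionFace f q.1).act q.2) (({y | height y ≠ 1} ×ˢ univ) ∩ C) →
      ContinuousWithinAt (fun q : SimplexSphere (n + 1) × K =>
        (ClutchSpace.sectionFace f q.1).act q.2)
          (({y | height y ≠ 1} ×ˢ univ) ∩ C) q := by
    intro C hC h
    by_cases hqC : q ∈ C
    · exact h q ⟨hq, hqC⟩
    · refine continuousWithinAt_of_notMem_closure fun hmem => hqC ?_
      exact hC.closure_subset (closure_mono inter_subset_right hmem)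
  refine ((key _ hc h1).union (key _ hf h2)).mono fun z hz => ?_
  rcases cone_union_face z.1 with h | h
  · exact Or.inl ⟨hz, h⟩
  · exact Or.inr ⟨hz, h⟩

/-- The principal `K`-bundle over the sphere of dimension `n + 1` which is obtained from a
continuous map `f` on the equator by clutching. -/
def clutchedBundle (f : C(SimplexSphere n, K)) :
    PrincipalBundle (SimplexSphere (n + 1)) K where
  Total := ClutchSpace f
  act := ClutchSpace.act
  act_one p := by
    rcases p with ⟨⟨y, k⟩ | ⟨y, k⟩⟩
    · exact congrArg (fun k' => ClutchSpace.mk (Sum.inl (y, k'))) (mul_one k)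
    · exact congrArg (fun k' => ClutchSpace.mk (Sum.inr (y, k'))) (mul_one k)
  act_mul p g h := by
    rcases p with ⟨⟨y, k⟩ | ⟨y, k⟩⟩
    · exact congrArg (fun k' => ClutchSpace.mk (Sum.inl (y, k'))) (mul_assoc k g h).symm
    · exact congrArg (fun k' => ClutchSpace.mk (Sum.inr (y, k'))) (mul_assoc k g h).symm
  proj := ClutchSpace.proj
  isPrincipal := by
    intro y
    by_cases hy : 0 < height y
    · refine Exists.elim (exists_trivialization_of_section (act := ClutchSpace.act (f := f))
        ClutchSpace.continuous_proj ClutchSpace.proj_act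
        (isOpen_lt continuous_const continuous_height) (ClutchSpace.sectionCone f)
        ClutchSpace.coordCone (fun x _ => ClutchSpace.proj_sectionCone x) ?_ ?_ ?_ ?_
        fun p g _ => ClutchSpace.coordCone_act p g) fun e h => ⟨e, h.1 ▸ hy, h.2⟩
      · exact ClutchSpace.continuousOn_sectionCone f
      · rw [ClutchSpace.isQuotientMap_mk.continuousOn_isOpen_iff
          ((isOpen_lt continuous_const continuous_height).preimage ClutchSpace.continuous_proj)]
        rintro (p | p) hp
        · refine ContinuousAt.continuousWithinAt ?_
          refine (IsOpenEmbedding.inl.continuousAt_iff).mp ?_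
          exact continuous_snd.continuousAt
        · exact absurd (show height p.1.1 = 0 from p.1.2) (ne_of_gt hp)
      · intro x hx g
        rw [← ClutchSpace.mk_inl_eq (mem_cone_of_height_pos hx)]
        rfl
      · rintro ⟨⟨⟨x, hx⟩, k⟩ | ⟨⟨x, hx⟩, k⟩⟩ hp
        · exact (ClutchSpace.mk_inl_eq hx k).symm
        · exact absurd (show height x = 0 from hx) (ne_of_gt hp)
    · have hy1 : height y ≠ 1 := fun h => hy (h ▸ one_pos)
      have hB : IsOpen {y : SimplexSphere (n + 1) | height y ≠ 1} :=
        isOpen_ne_fun continuous_height continuous_const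
      refine Exists.elim (exists_trivialization_of_section (act := ClutchSpace.act (f := f))
        ClutchSpace.continuous_proj ClutchSpace.proj_act hB (ClutchSpace.sectionFace f)
        ClutchSpace.coordFace (fun x _ => ClutchSpace.proj_sectionFace x) ?_ ?_ ?_ ?_
        fun p g _ => ClutchSpace.coordFace_act p g) fun e h => ⟨e, h.1 ▸ hy1, h.2⟩
      · exact ClutchSpace.continuousOn_sectionFace f
      · rw [ClutchSpace.isQuotientMap_mk.continuousOn_isOpen_iff
          (hB.preimage ClutchSpace.continuous_proj)]
        rintro (p | p) hp
        · refine ContinuousAt.continuousWithinAt ?_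
          refine (IsOpenEmbedding.inl.continuousAt_iff).mp ?_
          have hr : ContinuousAt (fun p : cone n × K => retract p.1.1) p := by
            have hc : ContinuousOn (fun p : cone n × K => retract p.1.1)
                {p | height p.1.1 ≠ 1} :=
              continuousOn_retract.comp (by fun_prop) fun p hp => ⟨p.1.2, hp⟩
            refine hc.continuousAt (IsOpen.mem_nhds ?_ hp)
            exact hB.preimage (by fun_prop)
          exact (f.continuous.continuousAt.comp hr).inv.mul continuous_snd.continuousAt
        · refine ContinuousAt.continuousWithinAt ?_
          refine (IsOpenEmbedding.inr.continuousAt_iff).mp ?_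
          exact continuous_snd.continuousAt
      · intro x hx g
        rcases cone_union_face x with h | h
        · rw [← ClutchSpace.mk_inl_eq' h]
          exact inv_mul_cancel_left _ _
        · rw [← ClutchSpace.mk_inr_eq h]
          rfl
      · rintro ⟨⟨⟨x, hx⟩, k⟩ | ⟨⟨x, hx⟩, k⟩⟩ hp
        · refine (ClutchSpace.mk_inl_eq' hx _).symm.trans ?_
          change ClutchSpace.mk (Sum.inl (⟨x, hx⟩, f (retract x) * ((f (retract x))⁻¹ * k))) = _
          rw [mul_inv_cancel_left]
          rfl
        · exact (ClutchSpace.mk_inr_eq hx k).symm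

end Clutching

end SimplexSphere

/-!
Local lifts `f̂ i` of `f` are local sections of `f^* K̂` whose transition functions are the
differences `f̂ i * (f̂ j)⁻¹`. The clutched bundle has one section over the star of the last vertex
and one over the complement of the last vertex, and their transition function is `f ∘ p`, which is
the suspension of `f`. This cocycle is lifted by the maps `f̂ i ∘ p` at the indices `(i, ∞)`, where
`∞` is the index `none`. On `V i ∩ V j ∩ V ∞` the coboundary of these lifts is
`(f̂ j * (f̂ i)⁻¹) ∘ p`, the inverse of the suspension of `f̂ i * (f̂ j)⁻¹`, whence the sign.
-/

/-- The open cover of `X` which consists of copies of `X`. Its suspension consists of copies of the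
star of the last vertex and of the complement of the last vertex. -/
def PtCover.univ (X : Type*) [TopologicalSpace X] : PtCover X :=
  ⟨fun _ => Set.univ, fun _ => isOpen_univ, fun _ => mem_univ _⟩

theorem PrincipalBundle.IsClass.cls_eq {X G : Type*} [TopologicalSpace X] [Group G]
    [TopologicalSpace G] [IsTopologicalGroup G] {P : PrincipalBundle X G} {c : CechH1 X G}
    (h : P.IsClass c) : P.cls = c :=
  P.exists_isClass.choose_spec.unique h

section CechH2

variable {X Z : Type*} [TopologicalSpace X] [CommGroup Z] [TopologicalSpace Z]
  [IsTopologicalGroup Z]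

theorem IsCocycle2.inv {U : PtCover X} {c : X → X → X → X → Z} (h : IsCocycle2 U c) :
    IsCocycle2 U c⁻¹ :=
  ⟨fun i j k => (h.1 i j k).inv, fun i j k l x hx => by
    simpa only [Pi.inv_apply, mul_inv, inv_one] using congrArg (·⁻¹) (h.2 i j k l x hx)⟩

theorem CechH2.mk_inv (c : Cocycle2 X Z) : CechH2.mk c⁻¹ = -CechH2.mk c := rfl

end CechH2

namespace CentralExtension

variable {X : Type*} [TopologicalSpace X] {Z : Type u} {K : Type v} [CommGroup Z]
  [TopologicalSpace Z] [IsTopologicalGroup Z] [Group K] [TopologicalSpace K]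

theorem exists_pullback_section (E : CentralExtension.{u, v, w} Z K) (f : C(X, K))
    {s : X → E.Ext} {A : Set X} (hs : ContinuousOn s A) (hsf : ∀ x ∈ A, E.quot (s x) = f x) :
    ∃ t : X → (E.pullback f).Total, ContinuousOn t A ∧ ∀ x ∈ A, (t x).1 = (x, s x) := by
  have exists_point : ∀ x, ∃ p : (E.pullback f).Total, x ∈ A → p.1 = (x, s x) := by
    intro x
    by_cases hx : x ∈ A
    · exact ⟨⟨(x, s x), hsf x hx⟩, fun _ => rfl⟩
    · obtain ⟨e, he⟩ := E.quot_surjective (f x)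
      exact ⟨⟨(x, e), he⟩, fun h => absurd h hx⟩
  choose t ht using exists_point
  exact ⟨t, IsInducing.subtypeVal.continuousOn_iff.mpr ((continuousOn_id.prodMk hs).congr ht), ht⟩

theorem IsConnecting0.isClass_pullback {E : CentralExtension.{u, v, w} Z K} {f : C(X, K)}
    {c : CechH1 X Z} (h : E.IsConnecting0 f c) : (E.pullback f).IsClass c := by
  obtain ⟨U, s, z, hz, hs, hsf, hsz, rfl⟩ := h
  choose t ht hts using fun i => E.exists_pullback_section f (hs i) (hsf i)
  refine ⟨U, t, ht, fun i x hx => congrArg Prod.fst (hts i x hx), z, hz, fun i j x hx => ?_, rfl⟩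
  have transition : s i x = s j x * E.incl (z.1 i j x) := by
    rw [← E.central, hsz i j x hx, inv_mul_cancel_right]
  refine Subtype.ext ?_
  change (t i x).1 = ((t j x).1.1, (t j x).1.2 * E.incl (z.1 i j x))
  rw [hts i x hx.1, hts j x hx.2, transition]

variable [IsTopologicalGroup K]

theorem isConnecting0_δ₀ (E : CentralExtension.{u, v, w} Z K) (f : C(X, K)) :
    E.IsConnecting0 f (E.δ₀ f) :=
  (E.exists_isConnecting0 f).choose_spec

theorem IsConnecting1.δ₁_eq [ParacompactSpace X] [T2Space X] {E : CentralExtension.{u, v, w} Z K}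
    {c : CechH1 X K} {d : CechH2 X Z} (h : E.IsConnecting1 c d) : E.δ₁ c = d :=
  (E.exists_isConnecting1 c).choose_spec.unique h

theorem cls_pullback (E : CentralExtension.{u, v, w} Z K) (f : C(X, K)) :
    (E.pullback f).cls = E.δ₀ f :=
  (E.isConnecting0_δ₀ f).isClass_pullback.cls_eq

end CentralExtension

namespace SimplexSphere

variable {n : ℕ}

section Suspension

theorem map_suspCochain0 {G H : Type*} [Group G] [Group H] (φ : G →* H)
    {U : SimplexSphere n → Set (SimplexSphere n)} {s : SimplexSphere n → SimplexSphere n → G}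
    {t : SimplexSphere n → SimplexSphere n → H} (hst : ∀ i, ∀ x ∈ U i, φ (s i x) = t i x)
    {i j : Option (SimplexSphere n)} {y : SimplexSphere (n + 1)}
    (hy : y ∈ suspSet U i ∩ suspSet U j) :
    φ (suspCochain0 s i j y) = suspCochain0 t i j y := by
  rcases i with _ | i <;> rcases j with _ | j
  case none.some => simp only [suspCochain0, map_inv, hst j _ (retract_mem hy.1 hy.2)]
  case some.none => exact hst i _ (retract_mem hy.2 hy.1)
  all_goals exact map_one φ

theorem suspCochain0_coboundary {Z G : Type*} [CommGroup Z] [Group G] {φ : Z →* G}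
    (hφ : ∀ z g, Commute (φ z) g) {U : SimplexSphere n → Set (SimplexSphere n)}
    {s : SimplexSphere n → SimplexSphere n → G}
    {z : SimplexSphere n → SimplexSphere n → SimplexSphere n → Z}
    (hz : ∀ i j, ∀ x ∈ U i ∩ U j, φ (z i j x) = s i x * (s j x)⁻¹)
    {i j k : Option (SimplexSphere n)} {y : SimplexSphere (n + 1)}
    (hy : y ∈ suspSet U i ∩ suspSet U j ∩ suspSet U k) :
    suspCochain0 s j k y * suspCochain0 s i j y * (suspCochain0 s i k y)⁻¹ =
      φ (suspCochain1 z i j k y)⁻¹ := by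
  have hz_comm : ∀ i j, ∀ x ∈ U i ∩ U j, φ (z i j x) = (s j x)⁻¹ * s i x := fun i j x hx => by
    rw [eq_inv_mul_iff_mul_eq, ← (hφ _ _).eq, hz i j x hx, inv_mul_cancel_right]
  rcases i with _ | i <;> rcases j with _ | j <;> rcases k with _ | k
  case some.some.none =>
    have hij := hz i j _ ⟨retract_mem hy.2 hy.1.1, retract_mem hy.2 hy.1.2⟩
    simp [suspCochain1, suspCochain0, hij]
  case some.none.some =>
    have hik := hz_comm i k _ ⟨retract_mem hy.1.2 hy.1.1, retract_mem hy.1.2 hy.2⟩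
    simp [suspCochain1, suspCochain0, hik]
  case none.some.some =>
    have hjk := hz_comm j k _ ⟨retract_mem hy.1.1 hy.1.2, retract_mem hy.1.1 hy.2⟩
    simp [suspCochain1, suspCochain0, hjk]
  all_goals simp [suspCochain1, suspCochain0]

theorem isCocycle1_suspCocycle0 {K : Type*} [Group K] [TopologicalSpace K] [IsTopologicalGroup K]
    (U : PtCover (SimplexSphere n)) (f : C(SimplexSphere n, K)) :
    IsCocycle1 (suspCover U) (suspCocycle0 f).1 :=
  ⟨fun _ _ => continuousOn_suspCochain0 (fun _ => f.continuous.continuousOn) _ _,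
    fun _ _ _ _ _ => suspCochain0_mul _ _ _ _ _⟩

variable {Z : Type*} [CommGroup Z] [TopologicalSpace Z] [IsTopologicalGroup Z]

theorem isCocycle2_suspCocycle1 {U : PtCover (SimplexSphere n)} {g : Cocycle1 (SimplexSphere n) Z}
    (hg : IsCocycle1 U g.1) : IsCocycle2 (suspCover U) (suspCocycle1 g).1 :=
  ⟨fun _ _ _ => continuousOn_suspCochain1 hg.1 _ _ _,
    fun _ _ _ _ _ hy => suspCochain1_mul hg _ _ _ _ _ hy⟩

theorem susp₁_mk (g : Cocycle1 (SimplexSphere n) Z) :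
    susp₁ (CechH1.mk g) = CechH2.mk (suspCocycle1 g) := rfl

end Suspension

section Connecting

variable {Z : Type u} {K : Type v} [CommGroup Z] [TopologicalSpace Z] [IsTopologicalGroup Z]
  [Group K] [TopologicalSpace K] [IsTopologicalGroup K]

theorem isConnecting1_susp₀ {E : CentralExtension.{u, v, w} Z K} {f : C(SimplexSphere n, K)}
    {c : CechH1 (SimplexSphere n) Z} (h : E.IsConnecting0 f c) :
    E.IsConnecting1 (susp₀ f) (-susp₁ c) := by
  obtain ⟨U, s, z, hz, hs, hsf, hsz, rfl⟩ := h
  refine ⟨suspCover U, suspCocycle0 f, fun i j => suspCochain0 s (suspIndex i) (suspIndex j),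
    (suspCocycle1 z)⁻¹, isCocycle1_suspCocycle0 U f, rfl, fun _ _ => ?_, fun _ _ _ hy => ?_,
    (isCocycle2_suspCocycle1 hz).inv, fun _ _ _ _ hy => ?_, ?_⟩
  · exact continuousOn_suspCochain0 hs _ _
  · exact map_suspCochain0 E.quot hsf hy
  · exact (suspCochain0_coboundary E.central hsz hy).symm
  · rw [susp₁_mk, CechH2.mk_inv]

theorem δ₁_susp₀ (E : CentralExtension.{u, v, w} Z K) (f : C(SimplexSphere n, K)) :
    E.δ₁ (susp₀ f) = -susp₁ (E.δ₀ f) :=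
  (isConnecting1_susp₀ (E.isConnecting0_δ₀ f)).δ₁_eq

end Connecting

section Clutching

variable {K : Type*} [Group K]

namespace ClutchSpace

variable {f : SimplexSphere n → K}

theorem act_one (p : ClutchSpace f) : p.act 1 = p := by
  rcases p with ⟨⟨y, k⟩ | ⟨y, k⟩⟩
  · exact congrArg (fun k' => mk (Sum.inl (y, k'))) (mul_one k)
  · exact congrArg (fun k' => mk (Sum.inr (y, k'))) (mul_one k)

theorem continuousOn_of_act [TopologicalSpace K] {T : Type*} [TopologicalSpace T]
    {σ : T → ClutchSpace f} {A : Set T}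
    (hσ : ContinuousOn (fun q : T × K => (σ q.1).act q.2) (A ×ˢ univ)) : ContinuousOn σ A := by
  simpa only [Function.comp_def, act_one] using
    hσ.comp (f := fun t => (t, 1)) (by fun_prop) fun t ht => ⟨ht, mem_univ _⟩

theorem sectionFace_eq_act_sectionCone {y : SimplexSphere (n + 1)} (hy : y ∈ cone n) :
    sectionFace f y = (sectionCone f y).act (f (retract y)) := by
  rw [← mk_inl_eq hy, ← act_one (sectionFace f y), ← mk_inl_eq' hy, mul_one]

theorem sectionCone_eq_act_sectionFace {y : SimplexSphere (n + 1)} (hy : y ∈ cone n) :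
    sectionCone f y = (sectionFace f y).act (f (retract y))⁻¹ := by
  rw [← mk_inl_eq' hy, mul_inv_cancel, mk_inl_eq, act_one]

end ClutchSpace

/-- The local sections of the clutched bundle, one for each set of a suspended cover: the section
over the cone for the star of the last vertex, and the section over the face for the others. -/
noncomputable def clutchSection (f : SimplexSphere n → K) :
    Option (SimplexSphere n) → SimplexSphere (n + 1) → ClutchSpace f
  | none => ClutchSpace.sectionCone f
  | some _ => ClutchSpace.sectionFace f

theorem proj_clutchSection (f : SimplexSphere n → K) (i : Option (SimplexSphere n))
    (y : SimplexSphere (n + 1)) : (clutchSection f i y).proj = y := by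
  cases i
  · exact ClutchSpace.proj_sectionCone y
  · exact ClutchSpace.proj_sectionFace y

theorem clutchSection_eq_act (f : SimplexSphere n → K)
    {U : SimplexSphere n → Set (SimplexSphere n)} {i j : Option (SimplexSphere n)}
    {y : SimplexSphere (n + 1)} (hy : y ∈ suspSet U i ∩ suspSet U j) :
    clutchSection f i y = (clutchSection f j y).act (suspCochain0 (fun _ => f) i j y) := by
  rcases i with _ | i <;> rcases j with _ | j
  case none.some =>
    exact ClutchSpace.sectionCone_eq_act_sectionFace (mem_cone_of_height_pos hy.1)
  case some.none =>
    exact ClutchSpace.sectionFace_eq_act_sectionCone (mem_cone_of_height_pos hy.2)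
  all_goals exact (ClutchSpace.act_one _).symm

variable [TopologicalSpace K] [IsTopologicalGroup K]

theorem continuousOn_clutchSection (f : C(SimplexSphere n, K))
    (U : SimplexSphere n → Set (SimplexSphere n)) (i : Option (SimplexSphere n)) :
    ContinuousOn (clutchSection f i) (suspSet U i) := by
  cases i
  · exact ClutchSpace.continuousOn_of_act (ClutchSpace.continuousOn_sectionCone f)
  · exact (ClutchSpace.continuousOn_of_act (ClutchSpace.continuousOn_sectionFace f)).mono
      fun _ hy => hy.1

theorem isClass_clutchedBundle (f : C(SimplexSphere n, K)) :
    (clutchedBundle f).IsClass (susp₀ f) :=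
  ⟨suspCover (PtCover.univ _), fun i => clutchSection f (suspIndex i),
    fun _ => continuousOn_clutchSection f _ _, fun _ _ _ => proj_clutchSection f _ _,
    suspCocycle0 f, isCocycle1_suspCocycle0 _ f, fun _ _ _ hy => clutchSection_eq_act f hy, rfl⟩

theorem cls_clutchedBundle (f : C(SimplexSphere n, K)) : (clutchedBundle f).cls = susp₀ f :=
  (isClass_clutchedBundle f).cls_eq

end Clutching

end SimplexSphere

theorem proposition4 {Z : Type u} [CommGroup Z] [TopologicalSpace Z] [IsTopologicalGroup Z]
    {K : Type v} [Group K] [TopologicalSpace K] [IsTopologicalGroup K]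
    (E : CentralExtension.{u, v, w} Z K) (n : ℕ) (f : C(SimplexSphere n, K)) :
    SimplexSphere.susp₀ f = (SimplexSphere.clutchedBundle f).cls ∧
    E.δ₁ (SimplexSphere.clutchedBundle f).cls = -SimplexSphere.susp₁ (E.δ₀ f) ∧
    E.δ₀ f = (E.pullback f).cls := by
  refine ⟨(SimplexSphere.cls_clutchedBundle f).symm, ?_, (E.cls_pullback f).symm⟩
  rw [SimplexSphere.cls_clutchedBundle, SimplexSphere.δ₁_susp₀]
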